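/- Let $p$ be an odd prime and let $n\ge 1$ be an integer. Conventions. For a finite $p$-group $P$, a category $\mathcal F$ on $P$ has the subgroups of $P$ as objects and injective group homomorphisms as morphisms, each of which is an isomorphism of $\mathcal F$ followed by an inclusion. A subgroup $Q\le P$ is fully $\mathcal F$-normalized if $|N_P(Q)|\ge |N_P(Q')|$ for all $Q'$ that are $\mathcal F$-isomorphic to $Q$. $\mathcal F$ is a saturated fusion system on $P$ if it contains all homomorphisms induced by conjugation by elements of $P$, $\operatorname{Aut}_P(P)$ is a Sylow $p$-subgroup of $\operatorname{Aut}_{\mathcal F}(P)$, and every isomorphism $\varphi:Q\to Q'$ in $\mathcal F$ with $Q'$ fully $\mathcal F$-normalized extends to a morphism $N_\varphi\to P$ in $\mathcal F$, where $N_\varphi$ is the set of $x\in N_P(Q)$ for which there is $y\in N_P(Q')$ with $\varphi(xzx^{-1})=y\varphi(z)y^{-1}$ for all $z\in Q$. A subgroup $W\le P$ is normal in $\mathcal F$ if $W\trianglelefteq P$ and every morphism $R_1\to R_2$ of $\mathcal F$ extends to a morphism $WR_1\to WR_2$ of $\mathcal F$ that maps $W$ onto $W$; $O_p(\mathcal F)$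 denotes the largest subgroup of $P$ that is normal in $\mathcal F$. If $P\le G$, then $\mathcal F_P(G)$ is the category on $P$ whose morphisms are the homomorphisms between subgroups of $P$ induced by conjugation by elements of $G$. (1) Let $q$ be a prime power such that the $p$-part of $q-1$ is $p^n$, let $G=\mathrm{SL}(p+1,q)$, and let $P$ be any Sylow $p$-subgroup of $G$. Then: (a) There is an isomorphism $P\cong C_{p^n}\wr C_p$ such that the following hold for the element $x\in P$ corresponding to a generator of the complement $C_p$ (the wreathing element). The element $x$ is conjugate in $G$ to the permutation matrix of a $p$-cycle. The commutator subgroup $P'$ is a direct product of $p-1$ cyclic groups of order $p^n$ with generators $a_1,\dots,a_{p-1}$ satisfying $xa_ix^{-1}=a_{i+1}$ for $1\le i\le p-2$ and $xa_{p-1}x^{-1}=a_1^{-1}\cdots a_{p-1}^{-1}$. The subgroup $P_0=\langle P',x\rangle$ has order $p^{n(p-1)+1}$ and nilpotence class $n(p-1)$, so it is of maximal class. (b) $\mathcal F_P(G)$ is a saturated fusion system on $P$, and $O_p(\mathcal F_P(G))=1$. (c) $P$ has nilpotence class $n(p-1)+1$. (d) $Z(P)$ has exponent $p^n$. (2) Consequently,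 the following bound is sharp for every odd prime $p$ and every $n\ge1$: if $P$ is a nontrivial finite $p$-group of nilpotence class at most $n(p-1)+1$ and $\mathcal F$ is a saturated fusion system on $P$ with $O_p(\mathcal F)=1$, then $Z(P)$ has exponent at most $p^n$. That is, there exist such $P$ and $\mathcal F$ for which $Z(P)$ has exponent exactly $p^n$. -/

import Mathlib

/-- A category on the group `P`: its objects are the subgroups of `P`, its morphisms are injective
group homomorphisms, and every morphism is an isomorphism of the category followed by an
inclusion. -/
structure CategoryOn (P : Type*) [Group P] where
  /-- The morphisms from `Q` to `R`. -/
  Hom : (Q R : Subgroup P) → Set (Q →* R)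
  injective_of_mem : ∀ {Q R : Subgroup P} {φ : Q →* R}, φ ∈ Hom Q R → Function.Injective φ
  id_mem : ∀ Q : Subgroup P, MonoidHom.id Q ∈ Hom Q Q
  comp_mem : ∀ {Q R S : Subgroup P} {φ : Q →* R} {ψ : R →* S},
    φ ∈ Hom Q R → ψ ∈ Hom R S → ψ.comp φ ∈ Hom Q S
  exists_factorization : ∀ {Q R : Subgroup P} {φ : Q →* R}, φ ∈ Hom Q R →
    ∃ (S : Subgroup P) (hS : S ≤ R) (e : Q ≃* S),
      e.toMonoidHom ∈ Hom Q S ∧ e.symm.toMonoidHom ∈ Hom S Q ∧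
      Subgroup.inclusion hS ∈ Hom S R ∧ φ = (Subgroup.inclusion hS).comp e.toMonoidHom

namespace CategoryOn

variable {P : Type*} [Group P] (F : CategoryOn P)

/-- `e` is an isomorphism in the category `F`. -/
def IsIso {Q R : Subgroup P} (e : Q ≃* R) : Prop :=
  e.toMonoidHom ∈ F.Hom Q R ∧ e.symm.toMonoidHom ∈ F.Hom R Q

/-- `Aut_F(Q)`, as a group of automorphisms of `Q`. -/
def aut (Q : Subgroup P) : Subgroup (MulAut Q) where
  carrier := {e | F.IsIso e}
  one_mem' := ⟨F.id_mem Q, F.id_mem Q⟩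
  mul_mem' := fun ha hb => ⟨F.comp_mem hb.1 ha.1, F.comp_mem ha.2 hb.2⟩
  inv_mem' := fun ha => ⟨ha.2, ha.1⟩

/-- `Aut_P(Q)`: the automorphisms of `Q` induced by conjugation by elements of `P`. -/
def conjAut (Q : Subgroup P) : Subgroup (MulAut Q) where
  carrier := {e | ∃ g : P, ∀ x : Q, (e x : P) = g * x * g⁻¹}
  one_mem' := ⟨1, fun x => by simp⟩
  mul_mem' := by
    rintro a b ⟨g, hg⟩ ⟨h, hh⟩
    refine ⟨g * h, fun x => ?_⟩
    rw [MulAut.mul_apply, hg, hh]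
    group
  inv_mem' := by
    rintro a ⟨g, hg⟩
    refine ⟨g⁻¹, fun x => ?_⟩
    have h := hg (a⁻¹ x)
    rw [MulAut.apply_inv_self] at h
    rw [h]
    group

/-- `Q` is fully `F`-normalized: `|N_P(Q)| ≥ |N_P(Q')|` for all `Q'` that are `F`-isomorphic
to `Q`. -/
def IsFullyNormalized (Q : Subgroup P) : Prop :=
  ∀ (Q' : Subgroup P) (e : Q ≃* Q'), F.IsIso e →
    Nat.card (Subgroup.normalizer (Q' : Set P)) ≤ Nat.card (Subgroup.normalizer (Q : Set P))

/-- The subgroup `N_φ` of an isomorphism `φ : Q → Q'`: all `x ∈ N_P(Q)` for which some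
`y ∈ N_P(Q')` satisfies `φ (x z x⁻¹) = y φ(z) y⁻¹` for all `z ∈ Q`. -/
def extensionDomain {Q Q' : Subgroup P} (φ : Q ≃* Q') : Subgroup P where
  carrier := {x | x ∈ Subgroup.normalizer (Q : Set P) ∧
    ∃ y ∈ Subgroup.normalizer (Q' : Set P), ∀ z w : Q, (w : P) = x * z * x⁻¹ →
      (φ w : P) = y * φ z * y⁻¹}
  one_mem' := by
    refine ⟨one_mem _, 1, one_mem _, fun z w h => ?_⟩
    have : w = z := Subtype.ext (by simpa using h)
    simp [this]
  mul_mem' := by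
    rintro a b ⟨ha, y, hy, hay⟩ ⟨hb, y', hy', hby⟩
    refine ⟨mul_mem ha hb, y * y', mul_mem hy hy', fun z w h => ?_⟩
    have hv : b * z * b⁻¹ ∈ Q := (Subgroup.mem_normalizer_iff.mp hb z).mp z.2
    have h1 := hby z ⟨_, hv⟩ rfl
    have h2 := hay ⟨_, hv⟩ w (by rw [h]; group)
    rw [h2, h1]
    group
  inv_mem' := by
    rintro a ⟨ha, y, hy, hay⟩
    refine ⟨inv_mem ha, y⁻¹, inv_mem hy, fun z w h => ?_⟩
    have h1 := hay w z (by rw [h]; group)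
    rw [h1]
    group

theorem le_extensionDomain {Q Q' : Subgroup P} (φ : Q ≃* Q') : Q ≤ extensionDomain φ := by
  intro x hx
  refine ⟨Subgroup.le_normalizer hx, φ ⟨x, hx⟩, Subgroup.le_normalizer (φ ⟨x, hx⟩).2,
    fun z w h => ?_⟩
  have : w = ⟨x, hx⟩ * z * (⟨x, hx⟩ : Q)⁻¹ := Subtype.ext (by simpa using h)
  rw [this]
  simp

/-- `F` is a saturated fusion system on the finite `p`-group `P`. -/
structure IsSaturated (p : ℕ) : Prop where
  /-- `F` contains every homomorphism induced by conjugation by an element of `P`. -/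
  conj_mem : ∀ {Q R : Subgroup P} (φ : Q →* R),
    (∃ g : P, ∀ x : Q, (φ x : P) = g * x * g⁻¹) → φ ∈ F.Hom Q R
  /-- Sylow axiom: `Aut_P(P)` is a Sylow `p`-subgroup of `Aut_F(P)`. -/
  sylow : ∃ S : Sylow p (F.aut ⊤), (S : Subgroup (F.aut ⊤)) = (conjAut ⊤).subgroupOf (F.aut ⊤)
  /-- Extension axiom: an isomorphism `φ : Q → Q'` of `F` with `Q'` fully `F`-normalized extends
  to a morphism `N_φ → P` of `F`. -/
  extension : ∀ {Q Q' : Subgroup P} (φ : Q ≃* Q'), F.IsIso φ → F.IsFullyNormalized Q' →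
    ∃ ψ ∈ F.Hom (extensionDomain φ) ⊤,
      ∀ z : Q, (ψ (Subgroup.inclusion (le_extensionDomain φ) z) : P) = φ z

/-- The morphisms of the normalizer `N_F(W)`: the morphisms `φ : R₁ → R₂` of `F` that extend to
a morphism `W R₁ → W R₂` of `F` mapping `W` onto `W`. -/
def normalizerHom (W R₁ R₂ : Subgroup P) : Set (R₁ →* R₂) :=
  {φ | φ ∈ F.Hom R₁ R₂ ∧ ∃ ψ ∈ F.Hom (W ⊔ R₁) (W ⊔ R₂),
    (∀ x : R₁, (ψ (Subgroup.inclusion le_sup_right x) : P) = φ x) ∧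
    (W.subgroupOf (W ⊔ R₁)).map ψ = W.subgroupOf (W ⊔ R₂)}

/-- `W` is normal in `F`, that is, `F = N_F(W)`. As `N_F(W)` is a category on `N_P(W)`, this says
that `N_P(W) = P` and that both categories have the same morphisms. -/
def IsNormal (W : Subgroup P) : Prop :=
  Subgroup.normalizer (W : Set P) = ⊤ ∧
    ∀ R₁ R₂ : Subgroup P, F.normalizerHom W R₁ R₂ = F.Hom R₁ R₂

/-- `W = O_p(F)`: `W` is the largest subgroup of `P` that is normal in `F`. -/
def IsPCore (W : Subgroup P) : Prop :=
  IsGreatest {V : Subgroup P | F.IsNormal V} W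

end CategoryOn

/-- The category `F_P(G)` on the subgroup `P` of `G`: its morphisms are the homomorphisms between
subgroups of `P` induced by conjugation by elements of `G`. -/
def groupFusion {G : Type*} [Group G] (P : Subgroup G) : CategoryOn P where
  Hom Q R := {φ | ∃ g : G, ∀ x : Q, ((φ x : P) : G) = g * ((x : P) : G) * g⁻¹}
  injective_of_mem := by
    rintro Q R φ ⟨g, hg⟩ x y h
    have h1 := hg x
    rw [h, hg y] at h1
    exact Subtype.ext (Subtype.ext (by simpa using h1.symm))
  id_mem Q := ⟨1, fun x => by simp⟩
  comp_mem := by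
    rintro Q R S φ ψ ⟨g, hg⟩ ⟨h, hh⟩
    refine ⟨h * g, fun x => ?_⟩
    rw [MonoidHom.comp_apply, hh, hg]
    group
  exists_factorization := by
    rintro Q R φ ⟨g, hg⟩
    have hinj : Function.Injective (R.subtype.comp φ) := by
      intro x y h
      have h1 := hg x
      have h' : φ x = φ y := Subtype.ext h
      rw [h', hg y] at h1
      exact Subtype.ext (Subtype.ext (by simpa using h1.symm))
    have hS : (R.subtype.comp φ).range ≤ R := by
      rintro _ ⟨x, rfl⟩
      exact (φ x).2
    refine ⟨(R.subtype.comp φ).range, hS, MonoidHom.ofInjective hinj, ⟨g, hg⟩, ⟨g⁻¹, ?_⟩,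
      ⟨1, fun x => by simp⟩, ?_⟩
    · intro y
      obtain ⟨x, rfl⟩ := (MonoidHom.ofInjective hinj).surjective y
      have h1 := hg x
      have h2 : (MonoidHom.ofInjective hinj).symm.toMonoidHom
          ((MonoidHom.ofInjective hinj) x) = x :=
        (MonoidHom.ofInjective hinj).symm_apply_apply x
      rw [h2]
      change _ = g⁻¹ * ((φ x : P) : G) * g⁻¹⁻¹
      rw [h1]
      group
    · ext x
      rfl

/-! Write W for the wreath product of C_{p^n} by C_p. Its base is the module of functions Z/p →
Z/p^n, on which the wreathing element acts as the cyclic shift T. Commutation with that element acts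
on the base as D = 1 - T, so nilpotency classes reduce to the nilpotency index of D. Put N = T - 1
and S = 1 + T + ⋯ + T^(p-1). Then NS = 0, and expanding S in powers of N gives N^(p-1) = S - p(1 +
Nb) for some b. Iterating modulo p^n gives D^(n(p-1)) = (-p)^(n-1) S, which is nonzero and is killed
by one more D. Hence W has class n(p-1) + 1. The commutator subgroup is the image of D, and
adjoining the wreathing element to it gives class one less. The center consists of the constant
functions, so its exponent is p^n.

W embeds in GL(p, q) by monomial matrices, and then in SL(p+1, q) by A ↦ diag(A, det A⁻¹). A count
of the p-part of the group order shows that the image is a Sylow subgroup. Saturation of F_P(G)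
holds for every finite group G and follows from Sylow's theorem.

For O_p = 1: a nontrivial normal subgroup of the fusion system has a nontrivial center, which is
abelian and strongly closed in P. As a normal subgroup of P, this center contains a nonidentity
constant diagonal element. Swapping a coordinate with the last one and dividing yields elements
supported on one coordinate. Products of these realize a diagonal matrix conjugate to the wreathing
element, by the character table of C_p. Both elements then lie in an abelian group, but they do not
commute (`eq_bot_of_comm_of_closed`). The sharpness example takes q prime, by Dirichlet's theorem.
-/

/-! ### The identity behind the nilpotency index of the difference operator. -/

open Polynomial in
/-- The `p`-th cyclotomic polynomial at `1 + X` is `X ^ (p - 1)` modulo `p`, with constant term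
`p`. -/
theorem exists_geom_sum_one_add_X_eq (p : ℕ) [hp : Fact p.Prime] :
    ∃ h : ℤ[X], ∑ i ∈ Finset.range p, (X + 1 : ℤ[X]) ^ i =
      X ^ (p - 1) + (p : ℤ[X]) * (1 + X * h) := by
  obtain ⟨m, rfl⟩ : ∃ m, p = m + 2 := ⟨p - 2, by have := hp.out.two_le; omega⟩
  have hdvd : ∀ i ∈ Finset.range m, m + 2 ∣ (m + 2).choose (i + 2) := fun i hi =>
    hp.out.dvd_choose_self (by omega) (by simpa using hi)
  refine ⟨∑ i ∈ Finset.range m, (((m + 2).choose (i + 2) / (m + 2) : ℕ) : ℤ[X]) * X ^ i, ?_⟩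
  have h := geom_sum_X_comp_X_add_one_eq_sum (R := ℤ) (m + 2)
  have h2 : (∑ i ∈ Finset.range (m + 2), (X : ℤ[X]) ^ i).comp (X + 1)
      = ∑ i ∈ Finset.range (m + 2), (X + 1 : ℤ[X]) ^ i := by
    rw [← coe_compRingHom_apply, map_sum]
    simp
  rw [← h2, h, Finset.sum_range_succ, Finset.sum_range_succ', mul_add, Finset.mul_sum,
    Finset.mul_sum]
  have h3 : ∀ i ∈ Finset.range m, ((m + 2).choose (i + 1 + 1) : ℤ[X]) * X ^ (i + 1) =
      ((m + 2 : ℕ) : ℤ[X]) *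
        (X * ((((m + 2).choose (i + 2) / (m + 2) : ℕ) : ℤ[X]) * X ^ i)) := by
    intro i hi
    have : ((m + 2).choose (i + 1 + 1) : ℤ[X]) =
        ((m + 2 : ℕ) : ℤ[X]) * (((m + 2).choose (i + 2) / (m + 2) : ℕ) : ℤ[X]) := by
      rw [← Nat.cast_mul, Nat.mul_div_cancel' (hdvd i hi)]
    rw [this]
    ring
  rw [Finset.sum_congr rfl h3]
  simp
  ring

/-- In a commutative ring with `p ^ n = 0`, an element `T` with `T ^ p = 1` satisfies
`(1 - T) ^ (n * (p - 1)) = (-p) ^ (n - 1) * (1 + T + ⋯ + T ^ (p - 1))`. -/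
theorem one_sub_pow_eq_of_pow_prime_eq_one {A : Type*} [CommRing A] (p : ℕ) [hp : Fact p.Prime]
    (hp2 : p ≠ 2) (k : ℕ) (hA : (p : A) ^ (k + 1) = 0) (T : A) (hT : T ^ p = 1) :
    (1 - T) ^ ((k + 1) * (p - 1)) = (((-p : ℤ) ^ k : ℤ) : A) * ∑ i ∈ Finset.range p, T ^ i := by
  -- As p is odd, the exponent is even, so 1 - T may be replaced by T - 1.
  rw [← neg_sub, Even.neg_pow ((hp.out.even_sub_one hp2).mul_left _)]
  obtain ⟨h, hh⟩ := exists_geom_sum_one_add_X_eq p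
  have hS := congrArg (Polynomial.aeval (T - 1)) hh
  simp only [map_sum, map_pow, map_add, map_mul, Polynomial.aeval_X, map_one, map_natCast,
    sub_add_cancel] at hS
  set N := T - 1 with hN
  set S := ∑ i ∈ Finset.range p, T ^ i with hSdef
  set b := Polynomial.aeval N h
  have hNS : N * S = 0 := by rw [hSdef, mul_comm, hN, geom_sum_mul, hT, sub_self]
  have hp1 : p - 1 ≠ 0 := by have := hp.out.two_le; omega
  have hN2 : N ^ (p - 1) * S = 0 := by
    obtain ⟨m, hm⟩ := Nat.exists_eq_succ_of_ne_zero hp1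
    rw [hm, pow_succ, mul_assoc, hNS, mul_zero]
  -- Since N kills S, this g acts on S as -1. Together with N^(p-1) = S + pg, it turns each further
  -- factor N^(p-1) into pg.
  set g : A := -(1 + N * b) with hg
  have hS' : N ^ (p - 1) = S + p * g := by rw [hS, hg]; ring
  have hgS : ∀ j, g ^ j * S = (-1) ^ j * S := by
    intro j
    induction j with
    | zero => simp
    | succ j ih =>
      have : g * S = -S := by rw [hg]; linear_combination (-b) * hNS
      rw [pow_succ, mul_assoc, this, mul_neg, ih, pow_succ]
      ring
  have key : ∀ j, N ^ ((j + 1) * (p - 1)) = (p * g) ^ j * N ^ (p - 1) := by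
    intro j
    induction j with
    | zero => simp
    | succ j ih =>
      rw [add_mul, pow_add, ih, one_mul, mul_assoc]
      nth_rw 1 [hS']
      rw [add_mul, mul_comm S, hN2, zero_add, pow_succ]
      ring
  rw [key, hS', mul_add, mul_pow, mul_assoc, hgS, ← mul_pow, ← pow_succ, mul_pow, hA]
  push_cast
  rw [neg_pow]
  ring

/-! ### Shift and difference operators on functions on Z/p. -/

/-- Translation by `1` on the functions `ZMod p → A`. -/
def shift (p : ℕ) (A : Type*) [AddCommGroup A] : AddMonoid.End (ZMod p → A) where
  toFun v t := v (t - 1)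
  map_zero' := rfl
  map_add' _ _ := rfl

/-- The difference operator `v ↦ v - shift v` on the functions `ZMod p → A`. -/
def diffOp (p : ℕ) (A : Type*) [AddCommGroup A] : AddMonoid.End (ZMod p → A) :=
  1 - shift p A

theorem shift_apply (p : ℕ) (A : Type*) [AddCommGroup A] (v : ZMod p → A) (t : ZMod p) :
    shift p A v t = v (t - 1) := rfl

theorem diffOp_apply (p : ℕ) (A : Type*) [AddCommGroup A] (v : ZMod p → A) :
    diffOp p A v = v - shift p A v := rfl

theorem shift_pow_apply (p : ℕ) (A : Type*) [AddCommGroup A] (k : ℕ) (v : ZMod p → A)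
    (t : ZMod p) : (shift p A ^ k) v t = v (t - k) := by
  induction k generalizing t with
  | zero => simp
  | succ k ih =>
    rw [pow_succ', AddMonoid.End.coe_mul, Function.comp_apply, shift_apply, ih]
    congr 1
    push_cast
    ring

theorem shift_pow_self (p : ℕ) (A : Type*) [AddCommGroup A] : shift p A ^ p = 1 := by
  ext v t
  rw [shift_pow_apply]
  simp

theorem natCast_pow_end_eq_zero (p n : ℕ) :
    ((p : AddMonoid.End (ZMod p → ZMod (p ^ n))) ^ n) = 0 := by
  rw [← Nat.cast_pow]
  ext v t
  rw [AddMonoid.End.natCast_apply]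
  simp only [Pi.smul_apply, nsmul_eq_mul, CharP.cast_eq_zero, zero_mul]
  rfl

/-- The endomorphism ring is not commutative, so the identity is proved in the commutative ring
Z[X]/ker, where X acts as the shift, and carried over by the injection into endomorphisms. -/
theorem diffOp_pow_eq (p : ℕ) [hp : Fact p.Prime] (hp2 : p ≠ 2) (k : ℕ) :
    diffOp p (ZMod (p ^ (k + 1))) ^ ((k + 1) * (p - 1)) =
      (((-p : ℤ) ^ k : ℤ) : AddMonoid.End (ZMod p → ZMod (p ^ (k + 1)))) *
        ∑ i ∈ Finset.range p, shift p (ZMod (p ^ (k + 1))) ^ i := by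
  let φ : Polynomial ℤ →+* AddMonoid.End (ZMod p → ZMod (p ^ (k + 1))) :=
    (Polynomial.aeval (shift p (ZMod (p ^ (k + 1))))).toRingHom
  let ψ := RingHom.kerLift φ
  let T : Polynomial ℤ ⧸ RingHom.ker φ := Ideal.Quotient.mk _ Polynomial.X
  have hψ : Function.Injective ψ := RingHom.kerLift_injective φ
  have hT : ψ T = shift p (ZMod (p ^ (k + 1))) := by
    change φ Polynomial.X = _
    exact Polynomial.aeval_X _
  have h := one_sub_pow_eq_of_pow_prime_eq_one p hp2 k
    (hψ (by rw [map_pow, map_natCast, map_zero, natCast_pow_end_eq_zero])) T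
    (hψ (by rw [map_pow, hT, map_one, shift_pow_self]))
  have h2 := congrArg ψ h
  simp only [map_pow, map_mul, map_sum, map_intCast, map_sub, map_one, hT] at h2
  exact h2

/-- At the delta function at 0, the sum of the shifts takes the value 1 at 0. The power of D
therefore takes the value (-p)^(n-1) there, which is nonzero modulo p^n. -/
theorem diffOp_pow_ne_zero (p : ℕ) [hp : Fact p.Prime] (hp2 : p ≠ 2) {n : ℕ} (hn : 1 ≤ n) :
    diffOp p (ZMod (p ^ n)) ^ (n * (p - 1)) ≠ 0 := by
  obtain ⟨k, rfl⟩ : ∃ k, n = k + 1 := ⟨n - 1, by omega⟩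
  intro h
  rw [diffOp_pow_eq p hp2] at h
  have h2 := congrFun (DFunLike.congr_fun h (Pi.single 0 1)) 0
  rw [AddMonoid.End.coe_mul, Function.comp_apply, AddMonoid.End.intCast_apply] at h2
  have h3 : (∑ i ∈ Finset.range p, shift p (ZMod (p ^ (k + 1))) ^ i)
      (Pi.single 0 1) 0 = 1 := by
    let ev : AddMonoid.End (ZMod p → ZMod (p ^ (k + 1))) →+ ZMod (p ^ (k + 1)) :=
      { toFun := fun f => f (Pi.single 0 1) 0
        map_zero' := rfl
        map_add' := fun _ _ => rfl }
    change ev _ = 1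
    rw [map_sum, Finset.sum_eq_single 0]
    · change (shift p (ZMod (p ^ (k + 1))) ^ 0) (Pi.single 0 1) 0 = 1
      simp
    · intro i hi hi0
      change (shift p (ZMod (p ^ (k + 1))) ^ i) (Pi.single 0 1) 0 = 0
      rw [shift_pow_apply, Pi.single_eq_of_ne]
      rw [zero_sub, neg_ne_zero]
      intro h0
      rw [ZMod.natCast_eq_zero_iff] at h0
      exact hi0 (Nat.eq_zero_of_dvd_of_lt h0 (by simpa using hi))
    · simp [hp.out.pos]
  rw [Pi.smul_apply, h3, zsmul_eq_mul, mul_one] at h2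
  change (((-p : ℤ) ^ k : ℤ) : ZMod (p ^ (k + 1))) = 0 at h2
  rw [ZMod.intCast_zmod_eq_zero_iff_dvd, neg_pow, (isUnit_one.neg.pow k).dvd_mul_left,
    ← Nat.cast_pow, Int.natCast_dvd_natCast] at h2
  have := (Nat.pow_dvd_pow_iff_le_right hp.out.one_lt).mp h2
  omega

theorem diffOp_pow_succ_eq_zero (p : ℕ) [hp : Fact p.Prime] (hp2 : p ≠ 2) {n : ℕ} (hn : 1 ≤ n) :
    diffOp p (ZMod (p ^ n)) ^ (n * (p - 1) + 1) = 0 := by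
  obtain ⟨k, rfl⟩ : ∃ k, n = k + 1 := ⟨n - 1, by omega⟩
  rw [pow_succ (diffOp p (ZMod (p ^ (k + 1)))), diffOp_pow_eq p hp2, mul_assoc, diffOp,
    geom_sum_mul_neg, shift_pow_self, sub_self, mul_zero]

/-! ### Commutators and lower central series in the wreath product. -/

/-- The wreath product of a cyclic group of order `p ^ n` by a cyclic group of order `p`. -/
abbrev CyclicWreath (p n : ℕ) : Type :=
  RegularWreathProduct (Multiplicative (ZMod (p ^ n))) (Multiplicative (ZMod p))

namespace CyclicWreath

open scoped commutatorElement

variable {p n : ℕ}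

/-- The base component of an element of the wreath product, written additively. -/
def leftFn (w : CyclicWreath p n) : ZMod p → ZMod (p ^ n) :=
  fun t => (w.left (Multiplicative.ofAdd t)).toAdd

/-- The inclusion of the base group. -/
def base : Multiplicative (ZMod p → ZMod (p ^ n)) →* CyclicWreath p n where
  toFun v := ⟨fun t => Multiplicative.ofAdd (v.toAdd t.toAdd), 1⟩
  map_one' := rfl
  map_mul' v w := by
    ext t
    · simp [RegularWreathProduct.mul_def]
    · simp [RegularWreathProduct.mul_def]

/-- The generator of the complement. -/
def gen : CyclicWreath p n := RegularWreathProduct.inl (Multiplicative.ofAdd 1)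

theorem ext_leftFn {w w' : CyclicWreath p n} (h : w.leftFn = w'.leftFn)
    (h' : w.right = w'.right) : w = w' :=
  RegularWreathProduct.ext h h'

@[simp] theorem leftFn_base (v : Multiplicative (ZMod p → ZMod (p ^ n))) :
    (base v).leftFn = v.toAdd := rfl

@[simp] theorem right_base (v : Multiplicative (ZMod p → ZMod (p ^ n))) :
    (base v).right = 1 := rfl

@[simp] theorem leftFn_inl (s : Multiplicative (ZMod p)) :
    leftFn (n := n) (RegularWreathProduct.inl s) = 0 := rfl

@[simp] theorem leftFn_one : (1 : CyclicWreath p n).leftFn = 0 := rfl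

theorem eq_base_of_right {w : CyclicWreath p n} (h : w.right = 1) :
    w = base (Multiplicative.ofAdd w.leftFn) :=
  ext_leftFn rfl h

theorem eq_base_mul_inl (w : CyclicWreath p n) :
    w = base (Multiplicative.ofAdd w.leftFn) * RegularWreathProduct.inl w.right := by
  ext t
  · simp [base, leftFn]
  · simp

variable (p n) in
/-- The image of the `k`-th power of the difference operator. -/
abbrev diffRange (k : ℕ) : AddSubgroup (ZMod p → ZMod (p ^ n)) :=
  AddMonoidHom.range (diffOp p (ZMod (p ^ n)) ^ k : AddMonoid.End (ZMod p → ZMod (p ^ n)))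

/-- 1 - T^i is D times a geometric sum in T, and everything commutes with D. -/
theorem sub_shift_pow_mem {k : ℕ} {v : ZMod p → ZMod (p ^ n)} (hv : v ∈ diffRange p n k) (i : ℕ) :
    v - (shift p (ZMod (p ^ n)) ^ i) v ∈ diffRange p n (k + 1) := by
  obtain ⟨u, rfl⟩ := hv
  refine ⟨(∑ j ∈ Finset.range i, shift p (ZMod (p ^ n)) ^ j) u, ?_⟩
  set S := shift p (ZMod (p ^ n)) with hS
  have hc : Commute (diffOp p (ZMod (p ^ n))) S := by
    rw [diffOp, ← hS]
    exact (Commute.one_left S).sub_left (Commute.refl S)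
  have h : (diffOp p (ZMod (p ^ n))) ^ (k + 1) * ∑ j ∈ Finset.range i, S ^ j =
      (1 - S ^ i) * diffOp p (ZMod (p ^ n)) ^ k := by
    rw [pow_succ, mul_assoc, diffOp, mul_neg_geom_sum, ← hS]
    exact (((Commute.one_left _).sub_left ((hc.symm.pow_left i).pow_right k))).symm.eq
  exact DFunLike.congr_fun h u

theorem shift_pow_mem {k : ℕ} {v : ZMod p → ZMod (p ^ n)} (hv : v ∈ diffRange p n k) (i : ℕ) :
    (shift p (ZMod (p ^ n)) ^ i) v ∈ diffRange p n k := by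
  have h1 := sub_shift_pow_mem hv i
  have h2 : diffRange p n (k + 1) ≤ diffRange p n k := by
    rintro _ ⟨u, rfl⟩
    exact ⟨diffOp p (ZMod (p ^ n)) u, rfl⟩
  rw [← sub_sub_cancel v ((shift p (ZMod (p ^ n)) ^ i) v)]
  exact sub_mem hv (h2 h1)

variable [hp : Fact p.Prime]

theorem leftFn_mul (w w' : CyclicWreath p n) : (w * w').leftFn =
    w.leftFn + (shift p (ZMod (p ^ n)) ^ w.right.toAdd.val) w'.leftFn := by
  ext t
  rw [Pi.add_apply, shift_pow_apply, ZMod.natCast_val, ZMod.cast_id]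
  change (w.left _ * w'.left (w.right⁻¹ * Multiplicative.ofAdd t)).toAdd = _
  rw [toAdd_mul, sub_eq_neg_add]
  rfl

theorem leftFn_commutator (w w' : CyclicWreath p n) : (⁅w, w'⁆).leftFn =
    (w.leftFn + (shift p (ZMod (p ^ n)) ^ w.right.toAdd.val) w'.leftFn) -
      (w'.leftFn + (shift p (ZMod (p ^ n)) ^ w'.right.toAdd.val) w.leftFn) := by
  have h1 : (⁅w, w'⁆).right = 1 := by
    simp [commutatorElement_def, mul_comm w.right]
  have h : ⁅w, w'⁆ * (w' * w) = w * w' := by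
    rw [commutatorElement_def]
    group
  have := congrArg leftFn h
  rw [leftFn_mul, h1, leftFn_mul, leftFn_mul] at this
  rw [eq_sub_iff_add_eq, ← this]
  simp

theorem right_commutator (w w' : CyclicWreath p n) : (⁅w, w'⁆).right = 1 := by
  simp [commutatorElement_def, mul_comm w.right]

theorem gen_conj_base (v : ZMod p → ZMod (p ^ n)) :
    gen * base (Multiplicative.ofAdd v) * gen⁻¹ =
      base (Multiplicative.ofAdd (shift p (ZMod (p ^ n)) v)) := by
  rw [mul_inv_eq_iff_eq_mul]
  have h1 : (1 : ZMod p).val = 1 := ZMod.val_one p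
  refine ext_leftFn ?_ ?_
  · rw [leftFn_mul, leftFn_mul]
    simp [gen, h1]
  · simp [gen]

theorem commutator_base_gen (v : ZMod p → ZMod (p ^ n)) :
    ⁅base (Multiplicative.ofAdd v), gen⁆ =
      base (Multiplicative.ofAdd (diffOp p (ZMod (p ^ n)) v)) := by
  have h1 : (1 : ZMod p).val = 1 := ZMod.val_one p
  refine ext_leftFn ?_ (right_commutator _ _)
  rw [leftFn_commutator]
  simp [gen, h1, diffOp_apply, -ofAdd_sub]

/-- The base component of the commutator is a difference of two terms of the form v - T^i v. The one
coming from `w'` vanishes when `w` lies in the base; otherwise both components must start at the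
same depth. The latter case occurs only at the first step of the lower central series. -/
theorem leftFn_commutator_mem {b m : ℕ} {w w' : CyclicWreath p n}
    (hw : w.leftFn ∈ diffRange p n m) (hw' : w'.leftFn ∈ diffRange p n b)
    (h : w.right = 1 ∨ m = b) : (⁅w, w'⁆).leftFn ∈ diffRange p n (m + 1) := by
  have h0 : (⁅w, w'⁆).leftFn =
    (w.leftFn - (shift p (ZMod (p ^ n)) ^ w'.right.toAdd.val) w.leftFn) -
      (w'.leftFn - (shift p (ZMod (p ^ n)) ^ w.right.toAdd.val) w'.leftFn) := by
    rw [leftFn_commutator]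
    abel
  rw [h0]
  refine sub_mem (sub_shift_pow_mem hw _) ?_
  rcases h with h | rfl
  · rw [h]
    simp
  · exact sub_shift_pow_mem hw' _

variable (p n) in
/-- The subgroup of the elements whose base component is in the image of the `k`-th power of the
difference operator. -/
def diffSubgroup (k : ℕ) : Subgroup (CyclicWreath p n) where
  carrier := {w | w.leftFn ∈ diffRange p n k}
  one_mem' := zero_mem (diffRange p n k)
  mul_mem' {a b} ha hb := by
    change (a * b).leftFn ∈ diffRange p n k
    rw [leftFn_mul]
    exact add_mem ha (shift_pow_mem hb _)
  inv_mem' {a} ha := by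
    have h : (a⁻¹ * a).leftFn = 0 := by rw [inv_mul_cancel]; rfl
    rw [leftFn_mul] at h
    change (a⁻¹).leftFn ∈ diffRange p n k
    rw [eq_neg_of_add_eq_zero_left h]
    exact neg_mem (shift_pow_mem ha _)

theorem mem_diffSubgroup {k : ℕ} {w : CyclicWreath p n} :
    w ∈ diffSubgroup p n k ↔ w.leftFn ∈ diffRange p n k := Iff.rfl

theorem commutator_le_diffSubgroup :
    commutator (CyclicWreath p n) ≤ diffSubgroup p n 1 ⊓ RegularWreathProduct.rightHom.ker := by
  refine Subgroup.commutator_le.mpr fun w _ w' _ => ⟨?_, right_commutator w w'⟩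
  exact leftFn_commutator_mem (b := 0) (m := 0) ⟨w.leftFn, rfl⟩ ⟨w'.leftFn, rfl⟩ (Or.inr rfl)

variable {H : Type*} [Group H]

theorem lowerCentralSeries_le_of_embedding (j : H →* CyclicWreath p n) {b : ℕ}
    (hj : j.range = diffSubgroup p n b) (k : ℕ) {h : H}
    (hh : h ∈ (⊤ : Subgroup H).lowerCentralSeries k) :
    (j h).leftFn ∈ diffRange p n (b + k) ∧ (k ≠ 0 → (j h).right = 1) := by
  have hmem : ∀ h, (j h).leftFn ∈ diffRange p n b := fun h => by
    rw [← mem_diffSubgroup, ← hj]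
    exact ⟨h, rfl⟩
  induction k generalizing h with
  | zero => exact ⟨hmem h, by simp⟩
  | succ k ih =>
    have hle : (⊤ : Subgroup H).lowerCentralSeries (k + 1) ≤
        (diffSubgroup p n (b + k + 1) ⊓ RegularWreathProduct.rightHom.ker).comap j := by
      rw [Subgroup.lowerCentralSeries_succ]
      refine Subgroup.commutator_le.mpr fun x hx y _ => ?_
      rw [Subgroup.mem_comap, map_commutatorElement]
      refine ⟨leftFn_commutator_mem (m := b + k) (b := b) (ih hx).1 (hmem y) ?_, right_commutator _ _⟩
      by_cases hk : k = 0
      · exact Or.inr (by simp [hk])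
      · exact Or.inl ((ih hx).2 hk)
    exact ⟨(hle hh).1, fun _ => (hle hh).2⟩

theorem mem_lowerCentralSeries_of_embedding (j : H →* CyclicWreath p n)
    (hinj : Function.Injective j) {b : ℕ} (hj : j.range = diffSubgroup p n b) (k : ℕ)
    (v : ZMod p → ZMod (p ^ n)) {h : H}
    (hh : j h = base (Multiplicative.ofAdd ((diffOp p (ZMod (p ^ n)) ^ (b + k)) v))) :
    h ∈ (⊤ : Subgroup H).lowerCentralSeries k := by
  induction k generalizing h with
  | zero => trivial
  | succ k ih =>
    obtain ⟨x, hx⟩ : gen ∈ j.range := by rw [hj]; exact zero_mem (diffRange p n b)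
    obtain ⟨h', hh'⟩ : base (Multiplicative.ofAdd ((diffOp p (ZMod (p ^ n)) ^ (b + k)) v))
        ∈ j.range := by
      rw [hj]
      exact ⟨(diffOp p (ZMod (p ^ n)) ^ k) v, by rw [pow_add]; rfl⟩
    have : h = ⁅h', x⁆ := by
      apply hinj
      rw [map_commutatorElement, hh', hx, commutator_base_gen, hh, ← add_assoc, pow_succ']
      rfl
    rw [this, Subgroup.lowerCentralSeries_succ]
    exact Subgroup.commutator_mem_commutator (ih hh') (Subgroup.mem_top x)

/-- Applied with b = 0 to the whole group and with b = 1 to the subgroup of maximal class. The two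
preceding lemmas identify the k-th term of the series, for k ≥ 1, with the image of D^(b+k) in the
base, so the class is read off from the last nonzero power of D. -/
theorem nilpotencyClass_of_embedding (hp2 : p ≠ 2) (hn : 1 ≤ n) (j : H →* CyclicWreath p n)
    (hinj : Function.Injective j) {b : ℕ} (hj : j.range = diffSubgroup p n b)
    (hb : b < n * (p - 1)) :
    Group.IsNilpotent H ∧ Group.nilpotencyClass H = n * (p - 1) + 1 - b := by
  have hbot : (⊤ : Subgroup H).lowerCentralSeries (n * (p - 1) + 1 - b) = ⊥ := by
    rw [eq_bot_iff]
    intro h hh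
    obtain ⟨h1, h2⟩ := lowerCentralSeries_le_of_embedding j hj _ hh
    rw [show b + (n * (p - 1) + 1 - b) = n * (p - 1) + 1 by omega, diffRange,
      diffOp_pow_succ_eq_zero p hp2 hn] at h1
    obtain ⟨u, hu⟩ := h1
    rw [Subgroup.mem_bot]
    apply hinj
    rw [map_one]
    exact ext_leftFn hu.symm (h2 (by omega))
  have hnil : Group.IsNilpotent H := Subgroup.nilpotent_iff_lowerCentralSeries.mpr ⟨_, hbot⟩
  refine ⟨hnil, le_antisymm (Subgroup.lowerCentralSeries_eq_bot_iff_nilpotencyClass_le.mp hbot) ?_⟩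
  by_contra hlt
  have hc : Group.nilpotencyClass H ≤ n * (p - 1) - b := by omega
  have hbot' := Subgroup.lowerCentralSeries_eq_bot_iff_nilpotencyClass_le.mpr hc
  apply diffOp_pow_ne_zero p hp2 hn
  ext1 v
  obtain ⟨h, hh⟩ : base (Multiplicative.ofAdd ((diffOp p (ZMod (p ^ n)) ^ (n * (p - 1))) v))
      ∈ j.range := by
    rw [hj]
    refine ⟨(diffOp p (ZMod (p ^ n)) ^ (n * (p - 1) - b)) v, ?_⟩
    change (diffOp p (ZMod (p ^ n)) ^ b * diffOp p (ZMod (p ^ n)) ^ (n * (p - 1) - b)) v = _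
    rw [← pow_add, show b + (n * (p - 1) - b) = n * (p - 1) by omega]
    rfl
  have hm := mem_lowerCentralSeries_of_embedding j hinj hj (n * (p - 1) - b) v
    (by rw [hh, show b + (n * (p - 1) - b) = n * (p - 1) by omega])
  rw [hbot', Subgroup.mem_bot] at hm
  rw [hm, map_one] at hh
  exact (congrArg leftFn hh).symm

end CyclicWreath

/-! ### The commutator subgroup, its generators, and the subgroup of maximal class. -/

namespace CyclicWreath

open scoped commutatorElement

variable {p n : ℕ}

/-- Extension by zero to `ZMod p` of a family indexed by `0, …, p - 2`. -/
def extendZero : (Fin (p - 1) → Multiplicative (ZMod (p ^ n))) →*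
    Multiplicative (ZMod p → ZMod (p ^ n)) where
  toFun v := Multiplicative.ofAdd fun t =>
    if h : t.val < p - 1 then (v ⟨t.val, h⟩).toAdd else 0
  map_one' := by
    rw [← ofAdd_zero]
    congr 1
    ext t
    simp
  map_mul' v w := by
    rw [← ofAdd_add]
    congr 1
    ext t
    rw [Pi.add_apply]
    split_ifs <;> simp

theorem extendZero_apply (v : Fin (p - 1) → Multiplicative (ZMod (p ^ n))) (t : ZMod p) :
    (extendZero v).toAdd t = if h : t.val < p - 1 then (v ⟨t.val, h⟩).toAdd else 0 := rfl

/-- The homomorphism sending the `i`-th standard generator to the difference of the standard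
generators `i` and `i + 1` of the base group. -/
def diffHom : (Fin (p - 1) → Multiplicative (ZMod (p ^ n))) →* CyclicWreath p n :=
  base.comp ((AddMonoidHom.toMultiplicative (diffOp p (ZMod (p ^ n)))).comp extendZero)

theorem diffHom_apply (v : Fin (p - 1) → Multiplicative (ZMod (p ^ n))) :
    diffHom v =
      base (Multiplicative.ofAdd (diffOp p (ZMod (p ^ n)) (extendZero v).toAdd)) := rfl

theorem diffOp_const {A : Type*} [AddCommGroup A] (c : A) :
    diffOp p A (fun _ => c) = 0 := by
  ext t
  simp [diffOp_apply, shift_apply]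

variable [hp : Fact p.Prime]

theorem eq_const_of_diffOp_eq_zero {A : Type*} [AddCommGroup A] {u : ZMod p → A}
    (h : diffOp p A u = 0) (t : ZMod p) : u t = u 0 := by
  have h1 : shift p A u = u := (sub_eq_zero.mp h).symm
  have h2 : ∀ k, (shift p A ^ k) u = u := by
    intro k
    induction k with
    | zero => rfl
    | succ k ih => rw [pow_succ, AddMonoid.End.coe_mul, Function.comp_apply, h1, ih]
  have h3 := congrFun (h2 t.val) t
  rw [shift_pow_apply, ZMod.natCast_val, ZMod.cast_id, sub_self] at h3
  exact h3.symm

theorem val_neg_one_not_lt : ¬ (-1 : ZMod p).val < p - 1 := by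
  obtain ⟨m, rfl⟩ : ∃ m, p = m + 1 := ⟨p - 1, by have := hp.out.pos; omega⟩
  rw [ZMod.val_neg_one]
  omega

theorem diffHom_injective : Function.Injective (diffHom (p := p) (n := n)) := by
  rw [injective_iff_map_eq_one]
  intro v hv
  have h1 : diffOp p (ZMod (p ^ n)) (extendZero v).toAdd = 0 := congrArg leftFn hv
  have h2 := eq_const_of_diffOp_eq_zero h1
  have h3 : (extendZero v).toAdd (-1) = 0 := by
    rw [extendZero_apply, dif_neg val_neg_one_not_lt]
  ext i
  have h4 : (extendZero v).toAdd ((i : ℕ) : ZMod p) = 0 := by rw [h2, ← h2 (-1), h3]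
  have hi : ((i : ℕ) : ZMod p).val = i := ZMod.val_cast_of_lt (by omega)
  rw [extendZero_apply, dif_pos (by rw [hi]; exact i.2)] at h4
  have : (⟨((i : ℕ) : ZMod p).val, by rw [hi]; exact i.2⟩ : Fin (p - 1)) = i := Fin.ext hi
  rw [this] at h4
  exact h4

theorem exists_extendZero (u : ZMod p → ZMod (p ^ n)) :
    ∃ v, diffOp p (ZMod (p ^ n)) (extendZero v).toAdd = diffOp p (ZMod (p ^ n)) u := by
  -- Constants are killed by D, so u may be shifted by a constant until its value at -1 vanishes.
  refine ⟨fun i => Multiplicative.ofAdd (u (i : ℕ) - u (-1)), ?_⟩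
  have : (extendZero fun i : Fin (p - 1) => Multiplicative.ofAdd (u (i : ℕ) - u (-1))).toAdd =
      u - fun _ => u (-1) := by
    ext t
    rw [extendZero_apply]
    split_ifs with h
    · simp
    · have ht : t = -1 := by
        apply ZMod.val_injective p
        have h1 := ZMod.val_lt t
        have h2 := ZMod.val_lt (-1 : ZMod p)
        have h3 := val_neg_one_not_lt (p := p)
        omega
      simp [ht]
  rw [this, map_sub, diffOp_const, sub_zero]

theorem range_diffHom_eq :
    (diffHom (p := p) (n := n)).range = diffSubgroup p n 1 ⊓ RegularWreathProduct.rightHom.ker := by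
  ext w
  constructor
  · rintro ⟨v, rfl⟩
    exact ⟨⟨(extendZero v).toAdd, by rw [pow_one]; rfl⟩, rfl⟩
  · rintro ⟨⟨u, hu⟩, h2⟩
    obtain ⟨v, hv⟩ := exists_extendZero u
    refine ⟨v, ext_leftFn ?_ h2.symm⟩
    rw [← hu, pow_one]
    exact hv

theorem commutator_eq_range_diffHom :
    commutator (CyclicWreath p n) = (diffHom (p := p) (n := n)).range := by
  refine le_antisymm (commutator_le_diffSubgroup.trans range_diffHom_eq.ge) ?_
  rintro _ ⟨v, rfl⟩
  rw [diffHom_apply, ← commutator_base_gen]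
  exact Subgroup.commutator_mem_commutator (Subgroup.mem_top _) (Subgroup.mem_top _)

theorem commutator_sup_zpowers_gen :
    commutator (CyclicWreath p n) ⊔ Subgroup.zpowers gen = diffSubgroup p n 1 := by
  apply le_antisymm
  · refine sup_le (commutator_le_diffSubgroup.trans inf_le_left) ?_
    rw [Subgroup.zpowers_le]
    exact zero_mem (diffRange p n 1)
  · intro w hw
    rw [eq_base_mul_inl w]
    refine mul_mem (Subgroup.mem_sup_left ?_) (Subgroup.mem_sup_right ?_)
    · rw [commutator_eq_range_diffHom, range_diffHom_eq]
      exact ⟨hw, rfl⟩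
    · refine ⟨(w.right.toAdd.val : ℤ), ?_⟩
      change gen ^ (w.right.toAdd.val : ℤ) = _
      rw [gen, ← map_zpow, ← ofAdd_zsmul]
      simp

/-- Each element is uniquely a product of an element of the image of `diffHom` and an element of the
complement. -/
theorem card_diffSubgroup_one : Nat.card (diffSubgroup p n 1) = p ^ (n * (p - 1) + 1) := by
  have hmem : ∀ x : (Fin (p - 1) → Multiplicative (ZMod (p ^ n))) × Multiplicative (ZMod p),
      diffHom x.1 * RegularWreathProduct.inl x.2 ∈ diffSubgroup p n 1 := by
    intro x
    rw [mem_diffSubgroup, leftFn_mul, diffHom_apply]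
    simp only [leftFn_base, toAdd_ofAdd, leftFn_inl, map_zero, add_zero]
    exact ⟨(extendZero x.1).toAdd, by rw [pow_one]; rfl⟩
  have : Function.Bijective (fun x : (Fin (p - 1) → Multiplicative (ZMod (p ^ n))) ×
      Multiplicative (ZMod p) => (
        ⟨diffHom x.1 * RegularWreathProduct.inl x.2, hmem x⟩ : diffSubgroup p n 1)) := by
    constructor
    · rintro ⟨v, s⟩ ⟨v', s'⟩ h
      have h1 := congrArg (fun y : diffSubgroup p n 1 => (y : CyclicWreath p n)) h
      have h2 : s = s' := by
        simpa [diffHom_apply] using congrArg RegularWreathProduct.right h1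
      subst h2
      simp only [mul_left_inj] at h1
      rw [diffHom_injective h1]
    · rintro ⟨w, hw⟩
      obtain ⟨v, hv⟩ : base (Multiplicative.ofAdd w.leftFn) ∈ (diffHom (p := p) (n := n)).range := by
        rw [range_diffHom_eq]
        exact ⟨hw, rfl⟩
      refine ⟨⟨v, w.right⟩, Subtype.ext ?_⟩
      change diffHom v * _ = w
      rw [hv, ← eq_base_mul_inl]
  rw [← Nat.card_congr (Equiv.ofBijective _ this), Nat.card_prod, Nat.card_fun,
    Nat.card_congr Multiplicative.toAdd, Nat.card_congr Multiplicative.toAdd, Nat.card_zmod,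
    Nat.card_zmod, Nat.card_fin, ← pow_mul, pow_succ]

theorem extendZero_mulSingle (i : Fin (p - 1)) :
    (extendZero (Pi.mulSingle i (Multiplicative.ofAdd (1 : ZMod (p ^ n))))).toAdd =
      Pi.single ((i : ℕ) : ZMod p) 1 := by
  have hi : ((i : ℕ) : ZMod p).val = i := ZMod.val_cast_of_lt (by omega)
  ext t
  rw [extendZero_apply]
  by_cases ht : t = ((i : ℕ) : ZMod p)
  · subst ht
    rw [dif_pos (by rw [hi]; exact i.2), Pi.single_eq_same]
    have : (⟨((i : ℕ) : ZMod p).val, by rw [hi]; exact i.2⟩ : Fin (p - 1)) = i := Fin.ext hi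
    rw [this, Pi.mulSingle_eq_same]
    rfl
  · rw [Pi.single_eq_of_ne ht]
    split_ifs with h
    · rw [Pi.mulSingle_eq_of_ne]
      · rfl
      · rintro rfl
        exact ht (by simp)
    · rfl

theorem gen_conj_diffHom (v : Fin (p - 1) → Multiplicative (ZMod (p ^ n))) :
    gen * diffHom v * gen⁻¹ = base (Multiplicative.ofAdd
      (diffOp p (ZMod (p ^ n)) (shift p (ZMod (p ^ n)) (extendZero v).toAdd))) := by
  rw [diffHom_apply, gen_conj_base]
  congr 2

theorem shift_single (t : ZMod p) :
    shift p (ZMod (p ^ n)) (Pi.single t 1) = Pi.single (t + 1) 1 := by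
  ext s
  rw [shift_apply, Pi.single_apply, Pi.single_apply]
  simp only [sub_eq_iff_eq_add]

theorem gen_conj_diffHom_mulSingle {i j : Fin (p - 1)} (h : (j : ℕ) = i + 1) :
    gen * diffHom (Pi.mulSingle i (Multiplicative.ofAdd (1 : ZMod (p ^ n)))) * gen⁻¹ =
      diffHom (Pi.mulSingle j (Multiplicative.ofAdd 1)) := by
  rw [gen_conj_diffHom, diffHom_apply, extendZero_mulSingle, extendZero_mulSingle, shift_single, h]
  push_cast
  rfl

theorem gen_conj_diffHom_mulSingle_last {i : Fin (p - 1)} (h : (i : ℕ) + 1 = p - 1) :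
    gen * diffHom (Pi.mulSingle i (Multiplicative.ofAdd (1 : ZMod (p ^ n)))) * gen⁻¹ =
      diffHom (fun _ => (Multiplicative.ofAdd 1)⁻¹) := by
  rw [gen_conj_diffHom, diffHom_apply, extendZero_mulSingle, shift_single]
  congr 2
  -- The delta functions at all points of Z/p add up to the constant 1, which D kills. Hence D of
  -- the delta function at -1 is minus the sum of the other generators.
  rw [← sub_eq_zero, ← map_sub]
  convert diffOp_const (p := p) (1 : ZMod (p ^ n)) using 2
  funext t
  have hm : ((i : ℕ) : ZMod p) + 1 = -1 := by
    rw [← Nat.cast_add_one, h, Nat.cast_sub hp.out.one_le]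
    simp
  rw [Pi.sub_apply, hm, extendZero_apply]
  by_cases ht : t = -1
  · rw [ht, dif_neg val_neg_one_not_lt]
    simp
  · rw [Pi.single_eq_of_ne ht, dif_pos]
    · simp
    · have h1 := ZMod.val_lt t
      have h2 := ZMod.val_lt (-1 : ZMod p)
      have h3 := val_neg_one_not_lt (p := p)
      have h4 : t.val ≠ (-1 : ZMod p).val := fun h' => ht (ZMod.val_injective p h')
      omega

variable {P : Type*} [Group P]

theorem map_symm_commutator (e : P ≃* CyclicWreath p n) :
    (e.symm.toMonoidHom.comp diffHom).range = commutator P := by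
  rw [MonoidHom.range_comp, ← commutator_eq_range_diffHom, commutator_def, Subgroup.map_commutator,
    Subgroup.map_top_of_surjective _ e.symm.surjective, commutator_def]

theorem exists_commutator_generators (e : P ≃* CyclicWreath p n) {x : P} (hx : e x = gen) :
    ∃ (f : (Fin (p - 1) → Multiplicative (ZMod (p ^ n))) ≃* commutator P)
      (a : Fin (p - 1) → P),
      (∀ i, a i = (f (Pi.mulSingle i (Multiplicative.ofAdd 1)) : P)) ∧
      (∀ i j : Fin (p - 1), (j : ℕ) = i + 1 → x * a i * x⁻¹ = a j) ∧
      (∀ i : Fin (p - 1), (i : ℕ) + 1 = p - 1 →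
        x * a i * x⁻¹ = (List.ofFn fun j => (a j)⁻¹).prod) := by
  have hinj : Function.Injective (e.symm.toMonoidHom.comp (diffHom (p := p) (n := n))) :=
    e.symm.injective.comp diffHom_injective
  refine ⟨(MonoidHom.ofInjective hinj).trans (MulEquiv.subgroupCongr (map_symm_commutator e)),
    fun i => e.symm (diffHom (Pi.mulSingle i (Multiplicative.ofAdd 1))), fun i => rfl,
    fun i j h => ?_, fun i h => ?_⟩
  · apply e.injective
    simp only [map_mul, map_inv, hx, MulEquiv.apply_symm_apply]
    exact gen_conj_diffHom_mulSingle h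
  · apply e.injective
    simp only [map_mul, map_inv, hx, MulEquiv.apply_symm_apply]
    rw [gen_conj_diffHom_mulSingle_last h, map_list_prod, List.map_ofFn]
    have h1 : (⇑e ∘ fun j => (e.symm (diffHom (Pi.mulSingle j
        (Multiplicative.ofAdd (1 : ZMod (p ^ n))))))⁻¹) =
        diffHom ∘ fun j => (Pi.mulSingle j (Multiplicative.ofAdd (1 : ZMod (p ^ n)))⁻¹ :
          Fin (p - 1) → Multiplicative (ZMod (p ^ n))) := by
      funext j
      simp [Pi.mulSingle_inv]
    rw [h1, ← List.map_ofFn, ← map_list_prod, List.prod_ofFn]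
    congr 1
    exact (Finset.univ_prod_mulSingle
      (fun _ : Fin (p - 1) => (Multiplicative.ofAdd (1 : ZMod (p ^ n)))⁻¹)).symm

theorem card_and_nilpotencyClass_commutator_sup (hp2 : p ≠ 2) (hn : 1 ≤ n)
    (e : P ≃* CyclicWreath p n) {x : P} (hx : e x = gen) (P₀ : Subgroup P)
    (hP₀ : P₀ = commutator P ⊔ Subgroup.zpowers x) :
    Nat.card P₀ = p ^ (n * (p - 1) + 1) ∧ Group.nilpotencyClass P₀ = n * (p - 1) := by
  have hmap : P₀.map e.toMonoidHom = diffSubgroup p n 1 := by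
    rw [hP₀, Subgroup.map_sup, MonoidHom.map_zpowers, commutator_def, Subgroup.map_commutator,
      Subgroup.map_top_of_surjective _ e.surjective, ← commutator_def, ← commutator_sup_zpowers_gen,
      ← hx]
    rfl
  have hinj : Function.Injective (e.toMonoidHom.comp P₀.subtype) :=
    e.injective.comp P₀.subtype_injective
  have hrange : (e.toMonoidHom.comp P₀.subtype).range = diffSubgroup p n 1 := by
    rw [MonoidHom.range_comp, Subgroup.range_subtype, hmap]
  -- This uses p ≥ 3; it is the bound on b required at b = 1.
  have hlt : 1 < n * (p - 1) := by
    have h2 : 2 ≤ p - 1 := by have := hp.out.two_le; omega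
    nlinarith
  constructor
  · rw [← card_diffSubgroup_one, ← hrange,
      Nat.card_congr (MonoidHom.ofInjective hinj).toEquiv]
  · rw [(nilpotencyClass_of_embedding hp2 hn _ hinj hrange hlt).2]
    omega

theorem nilpotencyClass_of_mulEquiv (hp2 : p ≠ 2) (hn : 1 ≤ n) (e : P ≃* CyclicWreath p n) :
    Group.IsNilpotent P ∧ Group.nilpotencyClass P = n * (p - 1) + 1 := by
  refine nilpotencyClass_of_embedding (b := 0) hp2 hn e.toMonoidHom e.injective ?_ ?_
  · rw [MonoidHom.range_eq_top.mpr e.surjective]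
    ext w
    exact ⟨fun _ => ⟨w.leftFn, rfl⟩, fun _ => Subgroup.mem_top w⟩
  · have h2 : 0 < p - 1 := by have := hp.out.two_le; omega
    exact Nat.mul_pos hn h2

/-! ### The center of the wreath product. -/

theorem exists_eq_base_const (hn : 1 ≤ n) {z : CyclicWreath p n}
    (hz : z ∈ Subgroup.center (CyclicWreath p n)) :
    ∃ c : ZMod (p ^ n), z = base (Multiplicative.ofAdd fun _ => c) := by
  have hc := Subgroup.mem_center_iff.mp hz
  have hr : z.right = 1 := by
    -- Commuting with the delta function at 0 forces the translation part to fix 0, hence to be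
    -- trivial. Commuting with the generator then puts the base part in the kernel of D.
    have h := congrArg leftFn (hc (base (Multiplicative.ofAdd (Pi.single 0 1))))
    rw [leftFn_mul, leftFn_mul] at h
    simp only [leftFn_base, right_base, toAdd_ofAdd, toAdd_one, ZMod.val_zero, pow_zero,
      AddMonoid.End.coe_one, id_eq] at h
    rw [add_comm, add_right_inj] at h
    have h2 := congrFun h 0
    rw [shift_pow_apply, Pi.single_eq_same, Pi.single_apply] at h2
    have : Fact (1 < p ^ n) := ⟨Nat.one_lt_pow (by omega) hp.out.one_lt⟩
    have h3 : (0 : ZMod p) - (z.right.toAdd.val : ℕ) = 0 := by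
      by_contra h0
      rw [if_neg h0] at h2
      exact one_ne_zero h2
    rw [ZMod.natCast_val, ZMod.cast_id, zero_sub, neg_eq_zero] at h3
    exact h3
  have hl : diffOp p (ZMod (p ^ n)) z.leftFn = 0 := by
    have h := hc gen
    rw [eq_base_of_right hr] at h
    have h2 := commutator_base_gen z.leftFn
    rw [commutatorElement_eq_one_iff_mul_comm.mpr h.symm] at h2
    exact (congrArg leftFn h2).symm
  refine ⟨z.leftFn 0, ext_leftFn ?_ hr⟩
  funext t
  exact eq_const_of_diffOp_eq_zero hl t

theorem base_const_mem_center (c : ZMod (p ^ n)) :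
    base (Multiplicative.ofAdd fun _ => c) ∈ Subgroup.center (CyclicWreath p n) := by
  rw [Subgroup.mem_center_iff]
  intro w
  refine ext_leftFn ?_ (by simp)
  rw [leftFn_mul, leftFn_mul, add_comm]
  simp only [leftFn_base, right_base, toAdd_ofAdd, toAdd_one, ZMod.val_zero, pow_zero,
    AddMonoid.End.coe_one, id_eq, add_left_inj]
  ext t
  rw [shift_pow_apply]

theorem exponent_center (hn : 1 ≤ n) (e : P ≃* CyclicWreath p n) :
    Monoid.exponent (Subgroup.center P) = p ^ n := by
  rw [Monoid.exponent_eq_of_mulEquiv (Subgroup.centerCongr e)]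
  apply Nat.dvd_antisymm
  · rw [Monoid.exponent_dvd_iff_forall_pow_eq_one]
    rintro ⟨z, hz⟩
    obtain ⟨c, rfl⟩ := exists_eq_base_const hn hz
    apply Subtype.ext
    change base _ ^ _ = 1
    rw [← map_pow, ← ofAdd_nsmul]
    convert map_one base
    ext t
    simp
  · have h := Monoid.pow_exponent_eq_one
      (⟨_, base_const_mem_center 1⟩ : Subgroup.center (CyclicWreath p n))
    have h2 := congrArg Subtype.val h
    change base _ ^ _ = 1 at h2
    rw [← map_pow, ← ofAdd_nsmul] at h2
    have h3 := congrFun (congrArg leftFn h2) 0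
    rw [leftFn_base, toAdd_ofAdd, leftFn_one, Pi.smul_apply, nsmul_eq_mul, mul_one] at h3
    exact (ZMod.natCast_eq_zero_iff _ _).mp h3

end CyclicWreath

/-! ### Saturation of F_P(G), and strongly closed subgroups. -/

section Fusion

variable {G : Type*} [Group G] {p : ℕ}

/-- An element of `p`-power order that normalizes a Sylow `p`-subgroup lies in it. -/
theorem Sylow.mem_of_pow_eq_one_of_mem_normalizer (P : Sylow p G) {g : G} {k : ℕ}
    (hg : g ^ p ^ k = 1) (hn : g ∈ Subgroup.normalizer ((P : Subgroup G) : Set G)) :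
    g ∈ (P : Subgroup G) := by
  have hz : IsPGroup p (Subgroup.zpowers g) := by
    rintro ⟨_, i, rfl⟩
    refine ⟨k, Subtype.ext ?_⟩
    change (g ^ i) ^ p ^ k = 1
    rw [← zpow_natCast, ← zpow_mul, mul_comm, zpow_mul, zpow_natCast, hg, one_zpow]
  have h := hz.inf_normalizer_sylow P
  exact (h.le ⟨Subgroup.mem_zpowers g, hn⟩).2

theorem groupFusion_isIso {P : Subgroup G} {Q R : Subgroup P} (e : Q ≃* R) (g : G)
    (hg : ∀ x : Q, ((e x : P) : G) = g * ((x : P) : G) * g⁻¹) : (groupFusion P).IsIso e := by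
  refine ⟨⟨g, hg⟩, g⁻¹, fun y => ?_⟩
  obtain ⟨x, rfl⟩ := e.surjective y
  have h : e.symm.toMonoidHom (e x) = x := e.symm_apply_apply x
  rw [h, hg]
  group

theorem pow_aut_apply {P : Subgroup G} {Q : Subgroup P} (α : MulAut Q) (g : G)
    (hg : ∀ x : Q, ((α x : P) : G) = g * ((x : P) : G) * g⁻¹) (k : ℕ) (x : Q) :
    (((α ^ k) x : P) : G) = g ^ k * ((x : P) : G) * (g ^ k)⁻¹ := by
  induction k generalizing x with
  | zero => simp
  | succ k ih =>
    rw [pow_succ, MulAut.mul_apply, ih, hg, pow_succ]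
    group

/-- The elements of `G` that act on `Q` as elements of `N_P(Q)`. -/
def autPreimage (P : Subgroup G) (Q : Subgroup P) : Subgroup G where
  carrier := {k | ∃ y ∈ Subgroup.normalizer (Q : Set P),
    ∀ u ∈ Q, k * (u : G) * k⁻¹ = (y * u * y⁻¹ : P)}
  one_mem' := ⟨1, one_mem _, fun u _ => by simp⟩
  mul_mem' := by
    rintro a b ⟨y, hy, hay⟩ ⟨z, hz, hbz⟩
    refine ⟨y * z, mul_mem hy hz, fun u hu => ?_⟩
    have h1 := hay _ ((Subgroup.mem_normalizer_iff.mp hz u).mp hu)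
    rw [← hbz u hu] at h1
    calc a * b * (u : G) * (a * b)⁻¹ = a * (b * u * b⁻¹) * a⁻¹ := by group
      _ = _ := by rw [h1]; congr 1; group
  inv_mem' := by
    rintro a ⟨y, hy, hay⟩
    refine ⟨y⁻¹, inv_mem hy, fun u hu => ?_⟩
    have h1 := hay _ ((Subgroup.mem_normalizer_iff.mp (inv_mem hy) u).mp hu)
    have h2 : y * (y⁻¹ * u * y⁻¹⁻¹) * y⁻¹ = u := by group
    rw [h2] at h1
    rw [← h1]
    group

theorem groupFusion_bot_isNormal (P : Subgroup G) : (groupFusion P).IsNormal ⊥ := by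
  refine ⟨?_, fun R₁ R₂ => Set.Subset.antisymm (fun φ h => h.1) fun φ h => ⟨h, ?_⟩⟩
  · rw [Subgroup.normalizer_eq_top_iff]
    infer_instance
  · obtain ⟨g, hg⟩ := h
    refine ⟨(Subgroup.inclusion le_sup_right).comp
      (φ.comp (Subgroup.inclusion (bot_sup_eq R₁).le)), ⟨g, fun x => ?_⟩, fun x => rfl, ?_⟩
    · exact hg (Subgroup.inclusion (bot_sup_eq R₁).le x)
    · simp

variable [hp : Fact p.Prime] [Finite G]

theorem mem_conjAut_of_pow_eq_one (P : Sylow p G)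
    {α : MulAut (⊤ : Subgroup (P : Subgroup G))}
    (hα : α ∈ (groupFusion (P : Subgroup G)).aut ⊤) {k : ℕ} (hk : α ^ p ^ k = 1) :
    α ∈ CategoryOn.conjAut (⊤ : Subgroup (P : Subgroup G)) := by
  obtain ⟨⟨g, hg⟩, -⟩ := hα
  replace hg : ∀ x : (⊤ : Subgroup (P : Subgroup G)),
    ((α x : (P : Subgroup G)) : G) = g * ((x : (P : Subgroup G)) : G) * g⁻¹ := hg
  have hnorm : g ∈ Subgroup.normalizer ((P : Subgroup G) : Set G) := by
    refine Subgroup.mem_normalizer_iff.mpr fun x => ⟨fun hx => ?_, fun hx => ?_⟩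
    · have := hg ⟨⟨x, hx⟩, Subgroup.mem_top _⟩
      rw [← this]
      exact SetLike.coe_mem _
    · obtain ⟨y, hy⟩ := α.surjective ⟨⟨g * x * g⁻¹, hx⟩, Subgroup.mem_top _⟩
      have h1 := hg y
      rw [hy] at h1
      have h2 : x = ((y : (P : Subgroup G)) : G) := by simpa using h1
      rw [h2]
      exact SetLike.coe_mem _
  obtain ⟨a, m, hm, ham⟩ := Nat.exists_eq_pow_mul_and_not_dvd (orderOf_pos g).ne' p hp.out.ne_one
  have hco : Nat.Coprime (p ^ k) m := Nat.Coprime.pow_left _ ((hp.out.coprime_iff_not_dvd).mpr hm)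
  -- With r ≡ 1 modulo the p-power p^k and r ≡ 0 modulo the p'-part m of the order of g, the power
  -- g^r is a p-element that still induces α. Normalizing P, it lies in P.
  obtain ⟨r, hr1, hr2⟩ := Nat.chineseRemainder hco 1 0
  have hαr : α ^ r = α := by
    have h1 : orderOf α ∣ p ^ k := orderOf_dvd_of_pow_eq_one hk
    have := (pow_eq_pow_iff_modEq (x := α)).mpr (hr1.of_dvd h1)
    rwa [pow_one] at this
  have hgr : (g ^ r) ^ p ^ a = 1 := by
    rw [← pow_mul, ← orderOf_dvd_iff_pow_eq_one, ham, mul_comm]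
    exact Nat.mul_dvd_mul_right ((Nat.modEq_zero_iff_dvd).mp hr2) _
  refine ⟨⟨g ^ r, P.mem_of_pow_eq_one_of_mem_normalizer hgr (pow_mem hnorm r)⟩, fun x => ?_⟩
  apply Subtype.ext
  have := pow_aut_apply α g hg r x
  rwa [hαr] at this

theorem groupFusion_sylow_axiom (P : Sylow p G) :
    ∃ S : Sylow p ((groupFusion (P : Subgroup G)).aut ⊤),
      (S : Subgroup ((groupFusion (P : Subgroup G)).aut ⊤)) =
        (CategoryOn.conjAut ⊤).subgroupOf ((groupFusion (P : Subgroup G)).aut ⊤) := by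
  refine ⟨{ toSubgroup := (CategoryOn.conjAut ⊤).subgroupOf ((groupFusion (P : Subgroup G)).aut ⊤)
            isPGroup' := ?_
            is_maximal' := ?_ }, rfl⟩
  · rintro ⟨⟨α, hα⟩, g, hg⟩
    obtain ⟨k, hk⟩ := P.2 g
    refine ⟨k, Subtype.ext (Subtype.ext (MulEquiv.ext fun x => Subtype.ext (Subtype.ext ?_)))⟩
    have h := pow_aut_apply α (g : G) (fun x => congrArg Subtype.val (hg x)) (p ^ k) x
    have hk' : (g : G) ^ p ^ k = 1 := congrArg Subtype.val hk
    rw [hk'] at h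
    simpa using h
  · intro Q hQ hle
    refine le_antisymm (fun α hα => ?_) hle
    obtain ⟨k, hk⟩ := hQ ⟨α, hα⟩
    refine mem_conjAut_of_pow_eq_one P α.2 (k := k) ?_
    exact congrArg (fun x : Q => (x : (groupFusion (P : Subgroup G)).aut ⊤).1) hk

/-- If `Q` is fully normalized, then `N_P(Q)` is a maximal `p`-subgroup of `N_G(Q)`. -/
theorem map_normalizer_eq_of_isFullyNormalized (P : Sylow p G) {Q : Subgroup (P : Subgroup G)}
    (hQ : (groupFusion (P : Subgroup G)).IsFullyNormalized Q) (T : Subgroup G)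
    (hT : IsPGroup p T)
    (hle : (Subgroup.normalizer (Q : Set (P : Subgroup G))).map (P : Subgroup G).subtype ≤ T)
    (hnorm : ∀ t ∈ T, ∀ u ∈ Q, ∃ v ∈ Q, (v : G) = t * u * t⁻¹) :
    (Subgroup.normalizer (Q : Set (P : Subgroup G))).map (P : Subgroup G).subtype = T := by
  -- Conjugate T into P. The image of Q is then F-isomorphic to Q and is normalized by the conjugate
  -- of T, so full normalization bounds |T| by |N_P(Q)|.
  obtain ⟨R, hR⟩ := hT.exists_le_sylow
  obtain ⟨h, rfl⟩ := MulAction.exists_smul_eq G P R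
  have hconj : ∀ t ∈ T, h⁻¹ * t * h ∈ (P : Subgroup G) := by
    intro t ht
    have := hR ht
    rw [Sylow.coe_subgroup_smul, Subgroup.mem_pointwise_smul_iff_inv_smul_mem] at this
    simpa [MulAut.smul_def] using this
  let c : T →* (P : Subgroup G) :=
    ((MulAut.conj h⁻¹).toMonoidHom.comp T.subtype).codRestrict _ fun t => by
      simpa using hconj t t.2
  have hc : ∀ t : T, ((c t : (P : Subgroup G)) : G) = h⁻¹ * t * h := fun t => by
    simp [c]
  have hcinj : Function.Injective c := by
    intro s t hst
    have := hc s
    rw [hst, hc t] at this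
    exact Subtype.ext (by simpa using this.symm)
  have hQT : ∀ u ∈ Q, (u : G) ∈ T := fun u hu =>
    hle ⟨u, Subgroup.le_normalizer hu, rfl⟩
  let d : Q →* (P : Subgroup G) := c.comp
    (((P : Subgroup G).subtype.comp Q.subtype).codRestrict T fun u => hQT u u.2)
  have hd : ∀ u : Q, ((d u : (P : Subgroup G)) : G) = h⁻¹ * u * h := fun u => hc _
  have hdinj : Function.Injective d := by
    intro s t hst
    have := hd s
    rw [hst, hd t] at this
    exact Subtype.ext (Subtype.ext (by simpa using this.symm))
  have hfull := hQ d.range (MonoidHom.ofInjective hdinj)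
    (groupFusion_isIso _ h⁻¹ fun u => by rw [inv_inv]; exact hd u)
  have hcn : ∀ t : T, c t ∈ Subgroup.normalizer (d.range : Set (P : Subgroup G)) := by
    have key : ∀ t : T, ∀ x ∈ d.range, c t * x * (c t)⁻¹ ∈ d.range := by
      rintro t _ ⟨u, rfl⟩
      obtain ⟨v, hv, hvt⟩ := hnorm t t.2 u u.2
      refine ⟨⟨v, hv⟩, Subtype.ext ?_⟩
      rw [hd]
      simp only [Subgroup.coe_mul, InvMemClass.coe_inv, hc, hd, hvt]
      group
    intro t
    refine Subgroup.mem_normalizer_iff.mpr fun x => ⟨key t x, fun hx => ?_⟩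
    have := key t⁻¹ _ hx
    rw [map_inv] at this
    convert this using 1
    group
  have hcard : Nat.card T ≤ Nat.card (Subgroup.normalizer (Q : Set (P : Subgroup G))) := by
    refine le_trans ?_ hfull
    exact Nat.card_le_card_of_injective (c.codRestrict _ hcn) fun s t hst =>
      hcinj (congrArg Subtype.val hst)
  refine Subgroup.eq_of_le_of_card_ge hle ?_
  rwa [Subgroup.card_map_of_injective (P : Subgroup G).subtype_injective]

/-- The group K below is N_P(Q') C_G(Q'), and N_P(Q') is a Sylow p-subgroup of it. If g induces φ,
then g carries N_φ to a p-subgroup of K. Sylow's theorem in K moves this subgroup into N_P(Q'), and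
the conjugating element can be corrected by an element of P so that it centralizes Q'. -/
theorem groupFusion_extension_axiom (P : Sylow p G) {Q Q' : Subgroup (P : Subgroup G)}
    (φ : Q ≃* Q') (hφ : (groupFusion (P : Subgroup G)).IsIso φ)
    (hQ' : (groupFusion (P : Subgroup G)).IsFullyNormalized Q') :
    ∃ ψ ∈ (groupFusion (P : Subgroup G)).Hom (CategoryOn.extensionDomain φ) ⊤,
      ∀ z : Q, (ψ (Subgroup.inclusion (CategoryOn.le_extensionDomain φ) z) : (P : Subgroup G)) =
        φ z := by
  obtain ⟨⟨g, hg⟩, -⟩ := hφ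
  replace hg : ∀ x : Q, ((φ x : (P : Subgroup G)) : G) = g * ((x : (P : Subgroup G)) : G) * g⁻¹ :=
    hg
  set N := Subgroup.normalizer (Q' : Set (P : Subgroup G)) with hN
  set K := autPreimage (P : Subgroup G) Q' with hK
  have hNK : N.map (P : Subgroup G).subtype ≤ K := by
    rintro _ ⟨y, hy, rfl⟩
    exact ⟨y, hy, fun u _ => rfl⟩
  have hNp : IsPGroup p (N.map (P : Subgroup G).subtype) := (P.2.to_subgroup N).map _
  let S : Sylow p K :=
    { toSubgroup := (N.map (P : Subgroup G).subtype).subgroupOf K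
      isPGroup' := hNp.comap_subtype
      is_maximal' := by
        -- Elements of K normalize Q', so a p-subgroup of K containing N_P(Q') satisfies the
        -- hypotheses of `map_normalizer_eq_of_isFullyNormalized`.
        intro T hT hle
        have h1 := map_normalizer_eq_of_isFullyNormalized P hQ' (T.map K.subtype) (hT.map _)
          (by
            intro y hy
            exact ⟨⟨y, hNK hy⟩, hle hy, rfl⟩)
          (by
            rintro _ ⟨t, -, rfl⟩ u hu
            obtain ⟨y, hy, h⟩ := t.2
            exact ⟨y * u * y⁻¹, (Subgroup.mem_normalizer_iff.mp hy u).mp hu, (h u hu).symm⟩)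
        rw [h1]
        exact (Subgroup.comap_map_eq_self_of_injective K.subtype_injective T).symm }
  have hMK : ∀ x ∈ CategoryOn.extensionDomain φ, g * (x : G) * g⁻¹ ∈ K := by
    rintro x ⟨hx, y, hy, hxy⟩
    refine ⟨y, hy, fun u hu => ?_⟩
    obtain ⟨z, hz⟩ := φ.surjective ⟨u, hu⟩
    have hzx : x * z * x⁻¹ ∈ Q := (Subgroup.mem_normalizer_iff.mp hx z).mp z.2
    have h1 := hxy z ⟨_, hzx⟩ rfl
    rw [hz] at h1
    rw [← h1, hg]
    have h2 := hg z
    rw [hz] at h2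
    change (u : G) = _ at h2
    rw [h2]
    simp only [Subgroup.coe_mul, InvMemClass.coe_inv]
    group
  let m : CategoryOn.extensionDomain φ →* K :=
    ((MulAut.conj g).toMonoidHom.comp
      ((P : Subgroup G).subtype.comp (CategoryOn.extensionDomain φ).subtype)).codRestrict K
        fun x => hMK x x.2
  have hMp : IsPGroup p m.range := by
    rw [MonoidHom.range_eq_map]
    exact ((P.2.to_subgroup _).to_subgroup ⊤).map m
  obtain ⟨R, hR⟩ := hMp.exists_le_sylow
  obtain ⟨k, rfl⟩ := MulAction.exists_smul_eq K S R
  obtain ⟨y, hy, hky⟩ := (k⁻¹).2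
  have hmem : ∀ x : CategoryOn.extensionDomain φ,
      (k⁻¹ : K) * (g * (x : G) * g⁻¹) * ((k⁻¹ : K) : G)⁻¹ ∈ N.map (P : Subgroup G).subtype := by
    intro x
    have h1 := hR ⟨x, rfl⟩
    rw [Sylow.coe_subgroup_smul, Subgroup.mem_pointwise_smul_iff_inv_smul_mem] at h1
    have h2 : (((MulAut.conj k)⁻¹ • m x : K) : G) ∈ N.map (P : Subgroup G).subtype := h1
    convert h2 using 1
    simp [MulAut.smul_def, m]
  -- k⁻¹ acts on Q' as y does, so c centralizes Q' and conjugation by cg still restricts to φ on Q.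
  set c : G := (y : G)⁻¹ * (k⁻¹ : K) with hc
  have hmem' : ∀ x : CategoryOn.extensionDomain φ,
      (c * g) * (x : G) * (c * g)⁻¹ ∈ (P : Subgroup G) := by
    intro x
    obtain ⟨w, -, hw⟩ := hmem x
    have : (c * g) * (x : G) * (c * g)⁻¹ = (y⁻¹ * w * y : (P : Subgroup G)) := by
      change (w : G) = _ at hw
      rw [Subgroup.coe_mul, Subgroup.coe_mul, hw, hc]
      simp only [InvMemClass.coe_inv]
      group
    rw [this]
    exact SetLike.coe_mem _
  refine ⟨(((MulAut.conj (c * g)).toMonoidHom.comp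
      ((P : Subgroup G).subtype.comp (CategoryOn.extensionDomain φ).subtype)).codRestrict _
        hmem').codRestrict ⊤ fun _ => Subgroup.mem_top _, ⟨c * g, fun x => rfl⟩, fun z => ?_⟩
  apply Subtype.ext
  change (c * g) * (z : G) * (c * g)⁻¹ = _
  have h1 := hky (φ z) (φ z).2
  calc (c * g) * (z : G) * (c * g)⁻¹
      = (y : G)⁻¹ * ((k⁻¹ : K) * (g * z * g⁻¹) * ((k⁻¹ : K) : G)⁻¹) * y := by rw [hc]; group
    _ = _ := by
      rw [← hg z, h1]
      simp only [Subgroup.coe_mul, InvMemClass.coe_inv]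
      group

theorem groupFusion_isSaturated (P : Sylow p G) :
    (groupFusion (P : Subgroup G)).IsSaturated p where
  conj_mem := fun _ ⟨g, hg⟩ => ⟨g, fun x => congrArg Subtype.val (hg x)⟩
  sylow := groupFusion_sylow_axiom P
  extension := groupFusion_extension_axiom P

/-- The center of a nontrivial normal subgroup of `F_P(G)` is an abelian strongly closed
subgroup. -/
theorem exists_strongly_closed_of_isNormal (P : Sylow p G) {V : Subgroup (P : Subgroup G)}
    (hV : (groupFusion (P : Subgroup G)).IsNormal V) (hne : V ≠ ⊥) :
    ∃ S : Subgroup G, S ≠ ⊥ ∧ S ≤ P ∧ (∀ s ∈ S, ∀ t ∈ S, s * t = t * s) ∧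
      ∀ s ∈ S, ∀ g : G, g * s * g⁻¹ ∈ (P : Subgroup G) → g * s * g⁻¹ ∈ S := by
  have hVnt : Nontrivial V := (Subgroup.nontrivial_iff_ne_bot V).mpr hne
  have hVp : IsPGroup p V := P.2.to_subgroup V
  have hZ := hVp.bot_lt_center
  refine ⟨((Subgroup.center V).map V.subtype).map (P : Subgroup G).subtype, ?_, ?_, ?_, ?_⟩
  · intro h
    rw [Subgroup.map_eq_bot_iff_of_injective _ (P : Subgroup G).subtype_injective,
      Subgroup.map_eq_bot_iff_of_injective _ V.subtype_injective] at h
    exact hZ.ne' h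
  · rintro _ ⟨x, -, rfl⟩
    exact x.2
  · rintro _ ⟨_, ⟨s, hs, rfl⟩, rfl⟩ _ ⟨_, ⟨t, ht, rfl⟩, rfl⟩
    have := Subgroup.mem_center_iff.mp ht s
    exact congrArg (fun x : V => ((x : (P : Subgroup G)) : G)) this
  · rintro _ ⟨_, ⟨s, hs, rfl⟩, rfl⟩ g hg
    change g * ((s : (P : Subgroup G)) : G) * g⁻¹ ∈ _ at hg
    set R : Subgroup (P : Subgroup G) := Subgroup.zpowers (s : (P : Subgroup G)) with hR
    have hRP : ∀ x : R, g * ((x : (P : Subgroup G)) : G) * g⁻¹ ∈ (P : Subgroup G) := by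
      rintro ⟨_, i, rfl⟩
      have := zpow_mem hg i
      rw [conj_zpow] at this
      exact this
    let φ : R →* (⊤ : Subgroup (P : Subgroup G)) :=
      (((MulAut.conj g).toMonoidHom.comp ((P : Subgroup G).subtype.comp R.subtype)).codRestrict _
        hRP).codRestrict ⊤ fun _ => Subgroup.mem_top _
    have hφ : φ ∈ (groupFusion (P : Subgroup G)).Hom R ⊤ := ⟨g, fun x => rfl⟩
    rw [← hV.2] at hφ
    obtain ⟨-, ψ, -, hψ1, hψ2⟩ := hφ
    set s' : R := ⟨s, Subgroup.mem_zpowers _⟩ with hs'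
    have h1 : ((ψ (Subgroup.inclusion le_sup_right s') : (P : Subgroup G)) : G) = g * s * g⁻¹ :=
      congrArg Subtype.val (hψ1 s')
    have h2 : ψ (Subgroup.inclusion le_sup_right s') ∈ V.subgroupOf (V ⊔ ⊤) := by
      rw [← hψ2]
      exact ⟨_, s.2, rfl⟩
    refine ⟨_, ⟨⟨_, h2⟩, ?_, rfl⟩, h1⟩
    -- The extension ψ maps V onto V, so every v in V is the image of some w in V. As w commutes
    -- with s, v commutes with the image of s.
    rw [SetLike.mem_coe, Subgroup.mem_center_iff]
    intro v
    have h3 : (⟨v, Subgroup.mem_sup_left v.2⟩ : (V ⊔ ⊤ : Subgroup (P : Subgroup G))) ∈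
        (V.subgroupOf (V ⊔ R)).map ψ := by
      rw [hψ2]
      exact v.2
    obtain ⟨w, hw, hwv⟩ := h3
    have h4 : w * Subgroup.inclusion le_sup_right s' = Subgroup.inclusion le_sup_right s' * w := by
      apply Subtype.ext
      have := Subgroup.mem_center_iff.mp hs ⟨w, hw⟩
      exact congrArg (fun x : V => (x : (P : Subgroup G))) this
    have h5 := congrArg ψ h4
    rw [map_mul, map_mul, hwv] at h5
    exact Subtype.ext (congrArg (fun x : (V ⊔ ⊤ : Subgroup (P : Subgroup G)) => x.1) h5)

end Fusion

/-- Take the last term of the lower central series that meets T nontrivially. Commutators of that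
intersection with the group lie in T and in the next term, hence are trivial. -/
theorem Subgroup.Normal.exists_mem_center {H : Type*} [Group H] [Group.IsNilpotent H]
    {T : Subgroup H} (hT : T.Normal) (hne : T ≠ ⊥) : ∃ z ∈ T, z ∈ Subgroup.center H ∧ z ≠ 1 := by
  classical
  have hex : ∃ k, T ⊓ (⊤ : Subgroup H).lowerCentralSeries k = ⊥ :=
    ⟨Group.nilpotencyClass H, by rw [Subgroup.lowerCentralSeries_nilpotencyClass, inf_bot_eq]⟩
  obtain ⟨k, hk⟩ : ∃ k, Nat.find hex = k + 1 := by
    refine Nat.exists_eq_succ_of_ne_zero fun h0 => hne ?_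
    have := Nat.find_spec hex
    rwa [h0, Subgroup.lowerCentralSeries_zero, inf_top_eq] at this
  have h1 : T ⊓ (⊤ : Subgroup H).lowerCentralSeries (k + 1) = ⊥ := hk ▸ Nat.find_spec hex
  have h2 : T ⊓ (⊤ : Subgroup H).lowerCentralSeries k ≠ ⊥ := Nat.find_min hex (by omega)
  obtain ⟨⟨z, hz⟩, hz1⟩ := Subgroup.ne_bot_iff_exists_ne_one.mp h2
  refine ⟨z, hz.1, Subgroup.mem_center_iff.mpr fun g => ?_,
    fun h => hz1 (Subtype.ext h)⟩
  have h3 : z * g * z⁻¹ * g⁻¹ ∈ T ⊓ (⊤ : Subgroup H).lowerCentralSeries (k + 1) := by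
    refine ⟨?_, ?_⟩
    · rw [mul_assoc z g, mul_assoc]
      exact mul_mem hz.1 (hT.conj_mem _ (inv_mem hz.1) g)
    · rw [Subgroup.lowerCentralSeries_succ]
      exact Subgroup.commutator_mem_commutator hz.2 (Subgroup.mem_top g)
  rw [h1, Subgroup.mem_bot, mul_inv_eq_one, mul_inv_eq_iff_eq_mul] at h3
  exact h3.symm

/-- If the order of the image of an embedding `ρ : W → G` is the `p`-part of `|G|`, then every Sylow
`p`-subgroup is isomorphic to `W` via `ρ` and a conjugation. -/
theorem Sylow.exists_mulEquiv_of_card {G W : Type*} [Group G] [Finite G] [Group W] {p : ℕ}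
    [Fact p.Prime] (ρ : W →* G) (hρ : Function.Injective ρ)
    (hcard : Nat.card W = p ^ (Nat.card G).factorization p) (P : Sylow p G) :
    ∃ (g : G) (e : P ≃* W), ∀ w, ((e.symm w : P) : G) = g * ρ w * g⁻¹ := by
  have hcard' : Nat.card ρ.range = p ^ (Nat.card G).factorization p := by
    rw [← hcard, Nat.card_congr (MonoidHom.ofInjective hρ).toEquiv]
  obtain ⟨g, rfl⟩ := MulAction.exists_smul_eq G (Sylow.ofCard ρ.range hcard') P
  have hinj : Function.Injective ((MulAut.conj g).toMonoidHom.comp ρ) :=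
    (MulAut.conj g).injective.comp hρ
  have hrange : ((MulAut.conj g).toMonoidHom.comp ρ).range =
      ((g • Sylow.ofCard ρ.range hcard' : Sylow p G) : Subgroup G) := by
    rw [MonoidHom.range_comp]
    rfl
  exact ⟨g, ((MonoidHom.ofInjective hinj).trans (MulEquiv.subgroupCongr hrange)).symm,
    fun w => rfl⟩

/-! ### The p-part of the order of SL(p+1, q), and roots of unity in K. -/

section Card

variable {K : Type*} [Field K]

theorem Matrix.card_GL_eq_card_SL_mul (m : ℕ) :
    Nat.card (Matrix.GeneralLinearGroup (Fin (m + 1)) K) =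
      Nat.card (Matrix.SpecialLinearGroup (Fin (m + 1)) K) * (Nat.card K - 1) := by
  classical
  let d : Matrix.GeneralLinearGroup (Fin (m + 1)) K →* Kˣ := Matrix.GeneralLinearGroup.det
  have hd : Function.Surjective d := Matrix.GeneralLinearGroup.det_surjective
  have hker : Nat.card d.ker = Nat.card (Matrix.SpecialLinearGroup (Fin (m + 1)) K) := by
    refine Nat.card_congr
      { toFun := fun A => ⟨A.1.1, congrArg Units.val A.2⟩
        invFun := fun A => ⟨Matrix.SpecialLinearGroup.toGL A, Units.ext A.2⟩
        left_inv := fun A => Subtype.ext (Units.ext rfl)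
        right_inv := fun A => rfl }
  rw [← Subgroup.card_mul_index d.ker, Subgroup.index_ker, hker, MonoidHom.range_eq_top.mpr hd,
    Subgroup.card_top, Nat.card_units]

variable [Finite K]

/-- Each factor of |GL(p+1, q)| is a power of q times q^m - 1 with 1 ≤ m ≤ p + 1, and lifting the
exponent gives it valuation n + v_p(m). The total is n(p+1) + 1, and the determinant removes n. -/
theorem factorization_card_SL {p : ℕ} [hp : Fact p.Prime] (hp2 : p ≠ 2) {n : ℕ} (hn : 1 ≤ n)
    (hK : padicValNat p (Nat.card K - 1) = n) :
    (Nat.card (Matrix.SpecialLinearGroup (Fin (p + 1)) K)).factorization p = n * p + 1 := by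
  have := Fintype.ofFinite K
  have hq : 1 < Fintype.card K := Fintype.one_lt_card
  have hdvd : p ∣ Fintype.card K - 1 := by
    rw [Nat.card_eq_fintype_card] at hK
    exact dvd_of_one_le_padicValNat (hK ▸ hn)
  have hndvd : ¬ p ∣ Fintype.card K := fun h => by
    have h1 := (Nat.dvd_sub_iff_right (by omega) h).mp hdvd
    exact hp.out.one_lt.ne' (Nat.dvd_one.mp h1)
  have h1 := congrArg (fun N => N.factorization p) (Matrix.card_GL_eq_card_SL_mul (K := K) p)
  rw [Matrix.card_GL_field] at h1
  have hterm : ∀ i : Fin (p + 1),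
      (Fintype.card K ^ (p + 1) - Fintype.card K ^ (i : ℕ)).factorization p =
        n + padicValNat p (p + 1 - i) := by
    intro i
    have hi : (p + 1) = i + (p + 1 - i) := by omega
    have hne : p + 1 - (i : ℕ) ≠ 0 := by omega
    have h2 : Fintype.card K ^ (p + 1) - Fintype.card K ^ (i : ℕ) =
        Fintype.card K ^ (i : ℕ) * (Fintype.card K ^ (p + 1 - (i : ℕ)) - 1 ^ (p + 1 - (i : ℕ))) := by
      rw [Nat.mul_sub, ← pow_add, ← hi, one_pow, mul_one]
    have h3 : Fintype.card K ^ (p + 1 - (i : ℕ)) - 1 ^ (p + 1 - (i : ℕ)) ≠ 0 := by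
      rw [one_pow]
      have := Nat.one_lt_pow hne hq
      omega
    rw [h2, Nat.factorization_mul (pow_ne_zero _ (by omega)) h3, Finsupp.add_apply,
      Nat.factorization_def _ hp.out, Nat.factorization_def _ hp.out,
      padicValNat.pow_sub_pow (hp.out.odd_of_ne_two hp2) hq hdvd hndvd hne,
      padicValNat.eq_zero_of_not_dvd (fun h => hndvd (hp.out.dvd_of_dvd_pow h)), zero_add,
      ← Nat.card_eq_fintype_card, hK]
  have hsum : ∑ i : Fin (p + 1), padicValNat p (p + 1 - i) = 1 := by
    have h1 : (1 : ℕ) < p + 1 := by have := hp.out.pos; omega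
    -- The only multiple of p among 1, …, p + 1 is p itself, which occurs at i = 1.
    rw [Finset.sum_eq_single (⟨1, h1⟩ : Fin (p + 1))]
    · simp
    · intro i _ hi
      apply padicValNat.eq_zero_of_not_dvd
      intro h
      have h4 : (i : ℕ) ≠ 1 := fun h' => hi (Fin.ext h')
      by_cases h0 : (i : ℕ) = 0
      · rw [h0, Nat.sub_zero, Nat.dvd_add_right dvd_rfl] at h
        exact hp.out.one_lt.ne' (Nat.dvd_one.mp h)
      · exact absurd (Nat.le_of_dvd (by omega) h) (by omega)
    · simp
  have hne : ∀ i : Fin (p + 1), Fintype.card K ^ (p + 1) - Fintype.card K ^ (i : ℕ) ≠ 0 := by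
    intro i
    have := Nat.pow_lt_pow_right hq i.2
    omega
  rw [Nat.factorization_prod_apply (fun i _ => hne i), Finset.sum_congr rfl (fun i _ => hterm i),
    Finset.sum_add_distrib, hsum, Nat.factorization_mul Nat.card_pos.ne'
      (by rw [Nat.card_eq_fintype_card]; omega), Finsupp.add_apply,
    Nat.factorization_def (Nat.card K - 1) hp.out, hK] at h1
  simp only [Finset.sum_const, Finset.card_univ, Fintype.card_fin, smul_eq_mul] at h1
  linarith

/-- A finite field `K` whose order satisfies `p ^ n ∣ |K| - 1` contains the `p ^ n`-th roots of
unity. -/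
theorem exists_injective_zmod_units {m : ℕ} (hm : m ∣ Nat.card K - 1) :
    ∃ ν : Multiplicative (ZMod m) →* Kˣ, Function.Injective ν := by
  rw [← Nat.card_units] at hm
  obtain ⟨u, hu⟩ := IsCyclic.exists_ofOrder_eq_natCard (α := Kˣ)
  obtain ⟨d, hd⟩ := hm
  have hord : orderOf (u ^ d) = m := by
    have hpos : 0 < Nat.card Kˣ := Nat.card_pos
    have hd0 : d ≠ 0 := by rintro rfl; simp at hd; omega
    rw [orderOf_pow_of_dvd hd0 (hu ▸ hd ▸ Dvd.intro_left m rfl), hu, hd,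
      Nat.mul_div_cancel _ (Nat.pos_of_ne_zero hd0)]
  have hcard : Nat.card (Subgroup.zpowers (u ^ d)) = m := by rw [Nat.card_zpowers, hord]
  clear hord hd
  subst hcard
  exact ⟨(Subgroup.zpowers (u ^ d)).subtype.comp
      (zmodCyclicMulEquiv (inferInstance : IsCyclic (Subgroup.zpowers (u ^ d)))).toMonoidHom,
    Subtype.val_injective.comp (MulEquiv.injective _)⟩

end Card

/-! ### The monomial representation. -/

namespace CyclicWreath

open scoped commutatorElement

variable {p n : ℕ} [hp : Fact p.Prime] {K : Type*} [Field K]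

/-- The monomial matrix of an element of the wreath product, with respect to an embedding `ν` of
the base of the wreath product into the units of `K`. -/
def monomialHom (ν : Multiplicative (ZMod (p ^ n)) →* Kˣ) :
    CyclicWreath p n →* Matrix (ZMod p) (ZMod p) K where
  toFun w := Matrix.of fun i j =>
    if i = w.right.toAdd + j then (ν (Multiplicative.ofAdd (w.leftFn i)) : K) else 0
  map_one' := by
    ext i j
    simp [Matrix.one_apply]
  map_mul' w w' := by
    ext i j
    rw [Matrix.mul_apply, Finset.sum_eq_single (i - w.right.toAdd)]
    · simp only [Matrix.of_apply, add_sub_cancel, if_true, mul_ite, mul_zero, leftFn_mul]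
      rw [Pi.add_apply, shift_pow_apply, ZMod.natCast_val, ZMod.cast_id, ofAdd_add, map_mul,
        RegularWreathProduct.mul_right, toAdd_mul, Units.val_mul]
      refine if_congr ?_ rfl rfl
      rw [sub_eq_iff_eq_add', add_assoc]
    · intro k _ hk
      rw [Matrix.of_apply, if_neg, zero_mul]
      rintro rfl
      exact hk (add_sub_cancel_left _ _).symm
    · simp

/-- The monomial representation of the wreath product. -/
def toGL (ν : Multiplicative (ZMod (p ^ n)) →* Kˣ) :
    CyclicWreath p n →* Matrix.GeneralLinearGroup (ZMod p) K :=
  (monomialHom ν).toHomUnits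

theorem toGL_val (ν : Multiplicative (ZMod (p ^ n)) →* Kˣ) (w : CyclicWreath p n) :
    (toGL ν w).val = monomialHom ν w := rfl

theorem monomialHom_base (ν : Multiplicative (ZMod (p ^ n)) →* Kˣ) (v : ZMod p → ZMod (p ^ n)) :
    monomialHom ν (base (Multiplicative.ofAdd v)) =
      Matrix.diagonal fun t => (ν (Multiplicative.ofAdd (v t)) : K) := by
  ext i j
  simp [monomialHom, Matrix.diagonal_apply]

theorem monomialHom_gen (ν : Multiplicative (ZMod (p ^ n)) →* Kˣ) :
    monomialHom ν gen = (Equiv.addRight (-1 : ZMod p) : Equiv.Perm (ZMod p)).permMatrix K := by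
  ext i j
  have h : i = 1 + j ↔ i + -1 = j := by
    rw [← sub_eq_add_neg, sub_eq_iff_eq_add']
  simp [monomialHom, gen, PEquiv.toMatrix_apply, h]

theorem toGL_injective {ν : Multiplicative (ZMod (p ^ n)) →* Kˣ} (hν : Function.Injective ν) :
    Function.Injective (toGL ν) := by
  rw [injective_iff_map_eq_one]
  intro w hw
  have h : ∀ i j, (monomialHom ν w) i j = (1 : Matrix (ZMod p) (ZMod p) K) i j := fun i j => by
    rw [← toGL_val, hw]
    rfl
  have hr : w.right.toAdd = 0 := by
    by_contra h0
    have := h (w.right.toAdd) 0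
    simp [monomialHom, h0] at this
  refine ext_leftFn ?_ hr
  funext i
  have := h i i
  simp only [monomialHom, hr, MonoidHom.coe_mk, OneHom.coe_mk, Matrix.of_apply, zero_add, if_true,
    Matrix.one_apply_eq, Units.val_eq_one] at this
  exact hν (this.trans (map_one ν).symm)

end CyclicWreath

/-! ### Embedding GL(m) in SL(m+1), and conjugation of diagonal matrices. -/

namespace Matrix

variable {m : Type*} [DecidableEq m] {K : Type*} [Field K]

theorem reindex_permMatrix {l : Type*} [DecidableEq l] (E : m ≃ l) (σ : Equiv.Perm m) :
    reindex E E (σ.permMatrix K) = (E.permCongr σ).permMatrix K := by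
  ext i j
  simp [PEquiv.toMatrix_apply, ← Equiv.eq_symm_apply]

theorem fromBlocks_permMatrix (σ : Equiv.Perm m) :
    fromBlocks (σ.permMatrix K) 0 0 (1 : Matrix Unit Unit K) =
      (Equiv.Perm.sumCongr σ (1 : Equiv.Perm Unit)).permMatrix K := by
  ext (i | i) (j | j) <;> simp [PEquiv.toMatrix_apply]

variable [Fintype m]

/-- The embedding `A ↦ diag(A, det A ^ (-1))` of the general linear group in dimension `m` into
the special linear group in dimension `m + 1`. -/
def GeneralLinearGroup.toSL : GeneralLinearGroup m K →* SpecialLinearGroup (m ⊕ Unit) K where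
  toFun A := ⟨fromBlocks A.1 0 0 (diagonal fun _ => A.1.det⁻¹), by
    have h : A.1.det ≠ 0 := ((isUnit_iff_isUnit_det _).mp A.isUnit).ne_zero
    rw [det_fromBlocks_zero₂₁, det_diagonal]
    simp [h]⟩
  map_one' := by
    apply Subtype.ext
    change fromBlocks (1 : Matrix m m K) 0 0 (diagonal fun _ => (1 : Matrix m m K).det⁻¹) = 1
    rw [det_one, inv_one, diagonal_one, fromBlocks_one]
  map_mul' A B := by
    apply Subtype.ext
    change fromBlocks (A.1 * B.1) 0 0 (diagonal fun _ => (A.1 * B.1).det⁻¹) =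
      fromBlocks A.1 0 0 (diagonal fun _ => A.1.det⁻¹) *
        fromBlocks B.1 0 0 (diagonal fun _ => B.1.det⁻¹)
    rw [fromBlocks_multiply, diagonal_mul_diagonal, det_mul, mul_inv]
    simp

theorem GeneralLinearGroup.toSL_val (A : GeneralLinearGroup m K) :
    (toSL A).1 = fromBlocks A.1 0 0 (diagonal fun _ => A.1.det⁻¹) := rfl

theorem GeneralLinearGroup.toSL_injective :
    Function.Injective (toSL : GeneralLinearGroup m K →* SpecialLinearGroup (m ⊕ Unit) K) := by
  intro A B h
  have h1 := congrArg Subtype.val h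
  rw [toSL_val, toSL_val, fromBlocks_inj] at h1
  exact Units.ext h1.1

/-- Reindexing of the special linear group. -/
def SpecialLinearGroup.reindexEquiv {l : Type*} [Fintype l] [DecidableEq l] (E : m ≃ l) :
    SpecialLinearGroup m K ≃* SpecialLinearGroup l K where
  toFun A := ⟨reindex E E A.1, by rw [det_reindex_self, A.2]⟩
  invFun A := ⟨reindex E.symm E.symm A.1, by rw [det_reindex_self, A.2]⟩
  left_inv A := Subtype.ext (by ext; simp)
  right_inv A := Subtype.ext (by ext; simp)
  map_mul' A B := Subtype.ext (by
    change reindex E E (A.1 * B.1) = reindex E E A.1 * reindex E E B.1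
    simp [submatrix_mul_equiv])

/-- Swapping two entries of a diagonal matrix is realized by conjugation in the special linear
group. -/
theorem SpecialLinearGroup.exists_conj_diagonal_swap {i j : m} (hij : i ≠ j) (a : m → K)
    (A B : SpecialLinearGroup m K) (hA : A.1 = diagonal a)
    (hB : B.1 = diagonal (a ∘ Equiv.swap i j)) :
    ∃ g : SpecialLinearGroup m K, g * A * g⁻¹ = B := by
  -- A transposition has determinant -1. The extra diagonal sign corrects this and commutes with
  -- diagonal matrices.
  have hdet : ((Equiv.swap i j).permMatrix K * diagonal (Function.update 1 j (-1))).det = 1 := by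
    rw [det_mul, det_permutation, Equiv.Perm.sign_swap hij, det_diagonal,
      Finset.prod_update_of_mem (Finset.mem_univ _)]
    simp
  refine ⟨(⟨_, hdet⟩ : SpecialLinearGroup m K), mul_inv_eq_iff_eq_mul.mpr (Subtype.ext ?_)⟩
  change _ * A.1 = B.1 * _
  rw [hA, hB]
  ext k l
  simp only [diagonal_mul, mul_diagonal, Function.comp_apply, PEquiv.toMatrix_apply,
    Equiv.toPEquiv_apply, Option.mem_some_iff]
  split_ifs with h
  · rw [h]; ring
  · simp

end Matrix

/-! ### Fusion of the wreath product in the special linear group. -/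

namespace CyclicWreath

open scoped commutatorElement
open Matrix

variable {p n : ℕ} [hp : Fact p.Prime] {K : Type*} [Field K]

/-- The embedding of the wreath product into the special linear group in dimension `p + 1`. -/
def toSL (ν : Multiplicative (ZMod (p ^ n)) →* Kˣ) :
    CyclicWreath p n →* SpecialLinearGroup (ZMod p ⊕ Unit) K :=
  GeneralLinearGroup.toSL.comp (toGL ν)

theorem toSL_base (ν : Multiplicative (ZMod (p ^ n)) →* Kˣ) (v : ZMod p → ZMod (p ^ n)) :
    (toSL ν (base (Multiplicative.ofAdd v))).1 = diagonal fun i =>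
      (ν (Multiplicative.ofAdd (Sum.elim v (fun _ : Unit => -∑ t, v t) i)) : K) := by
  have hdet : (monomialHom ν (base (Multiplicative.ofAdd v))).det⁻¹ =
      (ν (Multiplicative.ofAdd (-∑ t, v t)) : K) := by
    rw [monomialHom_base, det_diagonal, ofAdd_neg, map_inv, Units.val_inv_eq_inv_val, ofAdd_sum,
      map_prod, Units.coe_prod]
  change fromBlocks (monomialHom ν (base (Multiplicative.ofAdd v))) 0 0
    (diagonal fun _ => (monomialHom ν (base (Multiplicative.ofAdd v))).det⁻¹) = _
  rw [hdet, monomialHom_base, fromBlocks_diagonal]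
  congr 1
  funext i
  cases i <;> rfl

theorem addRight_neg_one_pow : (Equiv.addRight (-1 : ZMod p) : Equiv.Perm (ZMod p)) ^ p = 1 := by
  have h : ∀ k : ℕ, ∀ t, ((Equiv.addRight (-1 : ZMod p) : Equiv.Perm (ZMod p)) ^ k) t = t - k := by
    intro k
    induction k with
    | zero => simp
    | succ k ih =>
      intro t
      rw [pow_succ', Equiv.Perm.mul_apply, ih, Equiv.coe_addRight]
      push_cast
      ring
  ext t
  rw [h]
  simp

theorem toSL_gen (hp2 : p ≠ 2) (ν : Multiplicative (ZMod (p ^ n)) →* Kˣ) :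
    (toSL ν gen).1 = (Equiv.Perm.sumCongr (Equiv.addRight (-1 : ZMod p) : Equiv.Perm (ZMod p))
      (1 : Equiv.Perm Unit)).permMatrix K := by
  -- A permutation of odd order is even, so the added diagonal entry is 1.
  have hsign : Equiv.Perm.sign (Equiv.addRight (-1 : ZMod p) : Equiv.Perm (ZMod p)) = 1 := by
    have h := congrArg Equiv.Perm.sign (addRight_neg_one_pow (p := p))
    rw [map_pow, map_one] at h
    rcases Int.units_eq_one_or
      (Equiv.Perm.sign (Equiv.addRight (-1 : ZMod p) : Equiv.Perm (ZMod p))) with h' | h'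
    · exact h'
    · rw [h', (hp.out.odd_of_ne_two hp2).neg_one_pow] at h
      rw [h', h]
  change fromBlocks (monomialHom ν gen) 0 0 (diagonal fun _ => (monomialHom ν gen).det⁻¹) = _
  rw [monomialHom_gen, det_permutation, hsign, ← fromBlocks_permMatrix]
  simp

/-- The character table of a cyclic group of order `p` diagonalizes the generator of the
complement. -/
theorem exists_conj_gen {ν : Multiplicative (ZMod (p ^ n)) →* Kˣ} (hν : Function.Injective ν)
    {d : ZMod p →+ ZMod (p ^ n)} (hd : d ≠ 0) :
    ∃ g : SpecialLinearGroup (ZMod p ⊕ Unit) K,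
      g * toSL ν (base (Multiplicative.ofAdd fun t => d (-t))) * g⁻¹ = toSL ν gen := by
  have hinj : Function.Injective d := by
    rw [injective_iff_map_eq_zero]
    intro t ht
    by_contra h0
    apply hd
    ext x
    have : x = ((x * t⁻¹).val : ℕ) • t := by
      rw [nsmul_eq_mul, ZMod.natCast_val, ZMod.cast_id, inv_mul_cancel_right₀ h0]
    rw [this, map_nsmul, ht, smul_zero]
    rfl
  let χ : ZMod p → Multiplicative (ZMod p) →* K := fun i =>
    { toFun := fun k => (ν (Multiplicative.ofAdd (d (i * k.toAdd))) : K)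
      map_one' := by simp
      map_mul' := fun a b => by
        rw [toAdd_mul, mul_add, map_add, ofAdd_add, map_mul, Units.val_mul] }
  have hχ : Function.Injective χ := by
    intro i j hij
    have h1 := DFunLike.congr_fun hij (Multiplicative.ofAdd 1)
    have h2 := hinj (Multiplicative.ofAdd.injective (hν (Units.ext h1)))
    simpa using h2
  -- The rows are distinct characters, hence linearly independent. The relation (i - 1)k = ik - k
  -- says that shifting the rows of M multiplies its k-th column by the k-th diagonal entry.
  let M : Matrix (ZMod p) (ZMod p) K := of fun i k => (χ i (Multiplicative.ofAdd k) : K)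
  have hM : IsUnit M := by
    rw [← linearIndependent_rows_iff_isUnit]
    exact (linearIndependent_monoidHom (Multiplicative (ZMod p)) K).comp χ hχ
  obtain ⟨A, hA⟩ := hM
  refine ⟨GeneralLinearGroup.toSL A, ?_⟩
  rw [mul_inv_eq_iff_eq_mul, toSL, MonoidHom.comp_apply, MonoidHom.comp_apply, ← map_mul, ← map_mul]
  congr 1
  apply Units.ext
  change A.1 * monomialHom ν _ = monomialHom ν _ * A.1
  rw [hA, monomialHom_base, monomialHom_gen]
  ext i k
  rw [mul_diagonal, PEquiv.toMatrix_toPEquiv_mul]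
  change (ν _ : K) * ν _ = ν _
  rw [← Units.val_mul, ← map_mul, ← ofAdd_add, ← map_add]
  congr 4
  change i * k + -k = (i + -1) * k
  ring

/-- The image of the constant c has last exponent -pc. Swapping this with coordinate t changes that
coordinate by -(p+1)c. -/
theorem exists_conj_base_single (ν : Multiplicative (ZMod (p ^ n)) →* Kˣ) (c : ZMod (p ^ n))
    (t : ZMod p) : ∃ g : SpecialLinearGroup (ZMod p ⊕ Unit) K,
      g * toSL ν (base (Multiplicative.ofAdd fun _ => c)) * g⁻¹ =
        toSL ν (base (Multiplicative.ofAdd ((fun _ => c) + Pi.single t (-(p + 1) * c)))) := by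
  refine SpecialLinearGroup.exists_conj_diagonal_swap
    (show (Sum.inl t : ZMod p ⊕ Unit) ≠ Sum.inr () from Sum.inl_ne_inr) _ _ _ (toSL_base ν _) ?_
  rw [toSL_base]
  congr 1
  funext i
  simp only [Function.comp_apply]
  congr 3
  rcases i with i | i
  · by_cases h : i = t
    · subst h
      rw [Equiv.swap_apply_left]
      simp
      ring
    · rw [Equiv.swap_apply_of_ne_of_ne (by simpa using h) (by simp)]
      simp [h]
  · rw [Equiv.swap_apply_right]
    simp [Finset.sum_add_distrib, Finset.sum_pi_single']
    ring

/-- An abelian subgroup of the wreath product that is closed under fusion in the special linear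
group is trivial. -/
theorem eq_bot_of_comm_of_closed (hp2 : p ≠ 2) (hn : 1 ≤ n)
    {ν : Multiplicative (ZMod (p ^ n)) →* Kˣ} (hν : Function.Injective ν)
    (T : Subgroup (CyclicWreath p n)) (hcomm : ∀ s ∈ T, ∀ t ∈ T, s * t = t * s)
    (hclosed : ∀ s ∈ T, ∀ w, ∀ g : SpecialLinearGroup (ZMod p ⊕ Unit) K,
      g * toSL ν s * g⁻¹ = toSL ν w → w ∈ T) : T = ⊥ := by
  by_contra hne
  have hT : T.Normal := ⟨fun s hs w => hclosed s hs _ (toSL ν w) (by simp)⟩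
  have hnil := (nilpotencyClass_of_mulEquiv hp2 hn (MulEquiv.refl (CyclicWreath p n))).1
  obtain ⟨z, hzT, hz, hz1⟩ := hT.exists_mem_center hne
  obtain ⟨c, rfl⟩ := exists_eq_base_const hn hz
  let A : AddSubgroup (ZMod p → ZMod (p ^ n)) :=
    { carrier := {v | base (Multiplicative.ofAdd v) ∈ T}
      zero_mem' := one_mem T
      add_mem' := fun {a b} ha hb => by
        change base (Multiplicative.ofAdd a * Multiplicative.ofAdd b) ∈ T
        rw [map_mul]
        exact mul_mem ha hb
      neg_mem' := fun {a} ha => by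
        change base (Multiplicative.ofAdd a)⁻¹ ∈ T
        rw [map_inv]
        exact inv_mem ha }
  set c' : ZMod (p ^ n) := -(p + 1) * c with hc'
  -- Dividing the swapped element by the constant one leaves an element supported at t.
  have hsingle : ∀ t, Pi.single t c' ∈ A := by
    intro t
    obtain ⟨g, hg⟩ := exists_conj_base_single ν c t
    have h1 : (fun _ => c) + Pi.single t c' ∈ A := hclosed _ hzT _ g hg
    have h2 : (fun _ => c) ∈ A := hzT
    exact (A.add_mem_cancel_left h2).mp h1
  have hc'0 : c' ≠ 0 := by
    intro h0
    -- p + 1 is invertible modulo p^n, so c' = 0 would force c = 0.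
    have hu : IsUnit (-((p : ZMod (p ^ n)) + 1)) := by
      rw [IsUnit.neg_iff, ← Nat.cast_add_one, ZMod.isUnit_iff_coprime]
      exact Nat.Coprime.pow_right _ (by simp)
    rw [hc', hu.mul_right_eq_zero] at h0
    apply hz1
    rw [h0]
    rfl
  obtain ⟨d, hd, hdA⟩ : ∃ d : ZMod p →+ ZMod (p ^ n), d ≠ 0 ∧
      ∀ t, ∃ k : ℕ, d t = k • c' := by
    -- The multiple p^k c' has order p, so sending 1 to it defines a nonzero homomorphism d from Z/p
    -- whose values are multiples of c'.
    obtain ⟨k, hk, hk'⟩ : ∃ k : ℕ, p ^ k • c' ≠ 0 ∧ p ^ (k + 1) • c' = 0 := by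
      have hex : ∃ k, p ^ k • c' = 0 := ⟨n, by simp⟩
      classical
      obtain ⟨k, hk⟩ := Nat.exists_eq_succ_of_ne_zero
        (show Nat.find hex ≠ 0 from fun h => hc'0 (by
          have := Nat.find_spec hex
          rwa [h, pow_zero, one_smul] at this))
      exact ⟨k, Nat.find_min hex (by omega), by
        have := Nat.find_spec hex
        rwa [hk] at this⟩
    have hf : zmultiplesHom (ZMod (p ^ n)) (p ^ k • c') (p : ℤ) = 0 := by
      rw [zmultiplesHom_apply, natCast_zsmul, ← mul_nsmul, ← pow_succ, hk']
    have hval : ∀ i : ℕ, ZMod.lift p ⟨zmultiplesHom (ZMod (p ^ n)) (p ^ k • c'), hf⟩ (i : ZMod p) =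
        i • p ^ k • c' := by
      intro i
      have := ZMod.lift_coe p ⟨zmultiplesHom (ZMod (p ^ n)) (p ^ k • c'), hf⟩ (i : ℤ)
      rwa [Int.cast_natCast, zmultiplesHom_apply, natCast_zsmul] at this
    refine ⟨ZMod.lift p ⟨_, hf⟩, fun h => hk ?_, fun t => ⟨p ^ k * t.val, ?_⟩⟩
    · have := hval 1
      rwa [h, one_smul, AddMonoidHom.zero_apply, eq_comm] at this
    · have := hval t.val
      rwa [ZMod.natCast_val, ZMod.cast_id, ← mul_nsmul] at this
  have hall : ∀ v : ZMod p → ZMod (p ^ n), (∀ t, ∃ k : ℕ, v t = k • c') → v ∈ A := by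
    intro v hv
    rw [← Finset.univ_sum_single v]
    refine sum_mem fun t _ => ?_
    obtain ⟨k, hk⟩ := hv t
    rw [hk, Pi.single_smul]
    exact nsmul_mem (hsingle t) k
  have hy : base (Multiplicative.ofAdd fun t => d (-t)) ∈ T := hall _ fun t => hdA (-t)
  obtain ⟨g, hg⟩ := exists_conj_gen hν hd
  have hx : gen ∈ T := hclosed _ hy _ g hg
  -- T is abelian, so the diagonal element commutes with the generator. Then t ↦ d(-t) is constant,
  -- which forces d = 0.
  have h1 := commutatorElement_eq_one_iff_mul_comm.mpr (hcomm _ hy _ hx)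
  rw [commutator_base_gen] at h1
  have h2 : diffOp p (ZMod (p ^ n)) (fun t => d (-t)) = 0 := congrArg leftFn h1
  have h3 := eq_const_of_diffOp_eq_zero h2
  apply hd
  ext x
  simpa using h3 (-x)

end CyclicWreath

/-! ### Sylow subgroups of SL(p+1, q), and the main theorem. -/

open CyclicWreath Matrix in
theorem SL_sylow_properties (p : ℕ) [hp : Fact p.Prime] (hp2 : p ≠ 2) (n : ℕ) (hn : 1 ≤ n)
    (K : Type*) [Field K] [Finite K] (hK : padicValNat p (Nat.card K - 1) = n)
    (P : Sylow p (SpecialLinearGroup (Fin (p + 1)) K)) :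
    ∃ (e : P ≃* CyclicWreath p n) (x : P), e x = gen ∧
      (∃ (g : SpecialLinearGroup (Fin (p + 1)) K) (σ : Equiv.Perm (Fin (p + 1))),
        σ.IsCycle ∧ σ.support.card = p ∧
        ((g * (x : SpecialLinearGroup (Fin (p + 1)) K) * g⁻¹ :
          SpecialLinearGroup (Fin (p + 1)) K) : Matrix (Fin (p + 1)) (Fin (p + 1)) K) =
            σ.permMatrix K) ∧
      (groupFusion (P : Subgroup (SpecialLinearGroup (Fin (p + 1)) K))).IsPCore ⊥ := by
  obtain ⟨ν, hν⟩ : ∃ ν : Multiplicative (ZMod (p ^ n)) →* Kˣ, Function.Injective ν :=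
    exists_injective_zmod_units (hK ▸ pow_padicValNat_dvd)
  let E : ZMod p ⊕ Unit ≃ Fin (p + 1) := Fintype.equivOfCardEq (by simp [ZMod.card])
  let Φ : SpecialLinearGroup (ZMod p ⊕ Unit) K ≃* SpecialLinearGroup (Fin (p + 1)) K :=
    SpecialLinearGroup.reindexEquiv E
  have hinj : Function.Injective (Φ.toMonoidHom.comp (toSL ν)) :=
    Φ.injective.comp (GeneralLinearGroup.toSL_injective.comp (toGL_injective hν))
  obtain ⟨g, e, he⟩ := Sylow.exists_mulEquiv_of_card (Φ.toMonoidHom.comp (toSL ν)) hinj (by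
    rw [factorization_card_SL hp2 hn hK, RegularWreathProduct.card,
      Nat.card_congr Multiplicative.toAdd, Nat.card_congr Multiplicative.toAdd, Nat.card_zmod,
      Nat.card_zmod, ← pow_mul, pow_succ]) P
  refine ⟨e, e.symm gen, e.apply_symm_apply _, ⟨g⁻¹, E.permCongr (Equiv.Perm.sumCongr
    (Equiv.addRight (-1 : ZMod p) : Equiv.Perm (ZMod p)) (1 : Equiv.Perm Unit)), ?_⟩, ?_⟩
  · set τ := E.permCongr (Equiv.Perm.sumCongr
      (Equiv.addRight (-1 : ZMod p) : Equiv.Perm (ZMod p)) (1 : Equiv.Perm Unit)) with hτ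
    have hτp : τ ^ p = 1 := by
      have h : ∀ k : ℕ, τ ^ k = E.permCongr (Equiv.Perm.sumCongr
          ((Equiv.addRight (-1 : ZMod p) : Equiv.Perm (ZMod p)) ^ k) (1 : Equiv.Perm Unit)) := by
        intro k
        induction k with
        | zero => ext i; simp
        | succ k ih =>
          rw [pow_succ, ih, hτ, ← Equiv.permCongr_mul, Equiv.Perm.sumCongr_mul, pow_succ, one_mul]
      rw [h, addRight_neg_one_pow]
      ext i
      simp
    have hτ1 : τ ≠ 1 := by
      intro h
      have h1 := DFunLike.congr_fun h (E (Sum.inl 0))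
      simp [hτ] at h1
    have hord : orderOf τ = p := orderOf_eq_prime hτp hτ1
    -- A permutation of prime order p on p + 1 < 2p points has a single nontrivial cycle.
    have hcyc : τ.IsCycle := Equiv.Perm.isCycle_of_prime_order' (by rw [hord]; exact hp.out) (by
      rw [hord, Fintype.card_fin]
      have := hp.out.two_le
      omega)
    refine ⟨hcyc, hcyc.orderOf ▸ hord, ?_⟩
    rw [he]
    have h1 : g⁻¹ * (g * Φ.toMonoidHom.comp (toSL ν) gen * g⁻¹) * g⁻¹⁻¹ = Φ (toSL ν gen) := by
      change g⁻¹ * (g * Φ (toSL ν gen) * g⁻¹) * g⁻¹⁻¹ = _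
      group
    rw [h1]
    change reindex E E (toSL ν gen).1 = _
    rw [toSL_gen hp2, reindex_permMatrix]
  · refine ⟨groupFusion_bot_isNormal _, fun V hV => ?_⟩
    by_contra hne
    obtain ⟨S, hS1, hSP, hcomm, hclosed⟩ :=
      exists_strongly_closed_of_isNormal P hV fun h => hne h.le
    let j : CyclicWreath p n →* SpecialLinearGroup (Fin (p + 1)) K :=
      (P : Subgroup (SpecialLinearGroup (Fin (p + 1)) K)).subtype.comp e.symm.toMonoidHom
    have hj : Function.Injective j := Subtype.val_injective.comp e.symm.injective
    have hjw : ∀ w, j w = g * Φ (toSL ν w) * g⁻¹ := he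
    -- Strong closure of S in P transfers to the wreath product because `j` is the standard
    -- embedding followed by conjugation by g.
    have hbot : S.comap j = ⊥ := by
      refine eq_bot_of_comm_of_closed hp2 hn hν _ (fun s hs t ht => hj ?_) fun s hs w h hh => ?_
      · rw [map_mul, map_mul]
        exact hcomm _ hs _ ht
      · have h1 : (g * Φ h * g⁻¹) * j s * (g * Φ h * g⁻¹)⁻¹ = j w := by
          rw [hjw, hjw, ← hh]
          simp only [map_mul, map_inv]
          group
        have h2 := hclosed _ hs (g * Φ h * g⁻¹)
        rw [h1] at h2
        exact h2 (e.symm w).2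
    refine hS1 (eq_bot_iff.mpr fun s hs => ?_)
    have h3 : e ⟨s, hSP hs⟩ ∈ S.comap j := by
      rw [Subgroup.mem_comap]
      change ((e.symm (e ⟨s, hSP hs⟩) : P) : SpecialLinearGroup (Fin (p + 1)) K) ∈ S
      rwa [e.symm_apply_apply]
    rw [hbot, Subgroup.mem_bot, map_eq_one_iff e e.injective] at h3
    exact congrArg Subtype.val h3

/-- For every `n ≥ 1` there is a prime `q` such that the `p`-part of `q - 1` is `p ^ n`. -/
theorem exists_prime_padicValNat_sub_one (p : ℕ) [hp : Fact p.Prime] (n : ℕ) (hn : 1 ≤ n) :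
    ∃ q : ℕ, q.Prime ∧ padicValNat p (q - 1) = n := by
  have hu : IsUnit ((p ^ n + 1 : ℕ) : ZMod (p ^ (n + 1))) := by
    rw [ZMod.isUnit_iff_coprime]
    refine Nat.Coprime.pow_right _ ((hp.out.coprime_iff_not_dvd).mpr fun h => ?_).symm
    rw [Nat.dvd_add_right (dvd_pow_self p (by omega))] at h
    exact hp.out.one_lt.ne' (Nat.dvd_one.mp h)
  have : NeZero (p ^ (n + 1)) := ⟨pow_ne_zero _ hp.out.ne_zero⟩
  -- Dirichlet's theorem for the class of 1 + p^n modulo p^(n+1), which makes the p-part of q - 1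
  -- exactly p^n.
  obtain ⟨q, hq1, hq, hmod⟩ := Nat.forall_exists_prime_gt_and_eq_mod hu 1
  refine ⟨q, hq, ?_⟩
  have h1 : q - 1 ≡ p ^ n [MOD p ^ (n + 1)] := by
    rw [ZMod.natCast_eq_natCast_iff] at hmod
    refine Nat.ModEq.add_right_cancel' 1 ?_
    rwa [Nat.sub_add_cancel hq1.le]
  have hne : q - 1 ≠ 0 := by omega
  have hle : p ^ n ∣ q - 1 :=
    ((h1.of_dvd (pow_dvd_pow p n.le_succ)).dvd_iff dvd_rfl).mpr dvd_rfl
  have hnle : ¬ p ^ (n + 1) ∣ q - 1 := fun h => by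
    have := (Nat.pow_dvd_pow_iff_le_right hp.out.one_lt).mp ((h1.dvd_iff dvd_rfl).mp h)
    omega
  rw [padicValNat_dvd_iff_le hne] at hle hnle
  omega

theorem mainTheorem8 (p : ℕ) [Fact p.Prime] (hp : p ≠ 2) (n : ℕ) (hn : 1 ≤ n) :
    (∀ (K : Type*) [Field K] [Finite K], p ^ padicValNat p (Nat.card K - 1) = p ^ n →
      ∀ P : Sylow p (Matrix.SpecialLinearGroup (Fin (p + 1)) K),
        (∃ (e : P ≃* RegularWreathProduct (Multiplicative (ZMod (p ^ n)))
              (Multiplicative (ZMod p))) (x : P),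
          e x = RegularWreathProduct.inl (Multiplicative.ofAdd 1) ∧
          (∃ (g : Matrix.SpecialLinearGroup (Fin (p + 1)) K) (σ : Equiv.Perm (Fin (p + 1))),
            σ.IsCycle ∧ σ.support.card = p ∧
            ((g * (x : Matrix.SpecialLinearGroup (Fin (p + 1)) K) * g⁻¹ :
              Matrix.SpecialLinearGroup (Fin (p + 1)) K) : Matrix (Fin (p + 1)) (Fin (p + 1)) K)
                = σ.permMatrix K) ∧
          (∃ (f : (Fin (p - 1) → Multiplicative (ZMod (p ^ n))) ≃* commutator P)
              (a : Fin (p - 1) → P),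
            (∀ i, a i = (f (Pi.mulSingle i (Multiplicative.ofAdd 1)) : P)) ∧
            (∀ i j : Fin (p - 1), (j : ℕ) = i + 1 → x * a i * x⁻¹ = a j) ∧
            (∀ i : Fin (p - 1), (i : ℕ) + 1 = p - 1 →
              x * a i * x⁻¹ = (List.ofFn fun j => (a j)⁻¹).prod)) ∧
          (∀ P₀ : Subgroup P, P₀ = commutator P ⊔ Subgroup.zpowers x →
            Nat.card P₀ = p ^ (n * (p - 1) + 1) ∧
            Group.nilpotencyClass P₀ = n * (p - 1))) ∧
        (groupFusion (P : Subgroup (Matrix.SpecialLinearGroup (Fin (p + 1)) K))).IsSaturated p ∧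
        (groupFusion (P : Subgroup (Matrix.SpecialLinearGroup (Fin (p + 1)) K))).IsPCore ⊥ ∧
        Group.nilpotencyClass P = n * (p - 1) + 1 ∧
        Monoid.exponent (Subgroup.center P) = p ^ n) ∧
    (∃ (P : Type) (_ : Group P) (F : CategoryOn P),
      Finite P ∧ Nontrivial P ∧ IsPGroup p P ∧
      Group.IsNilpotent P ∧ Group.nilpotencyClass P ≤ n * (p - 1) + 1 ∧
      F.IsSaturated p ∧ F.IsPCore ⊥ ∧
      Monoid.exponent (Subgroup.center P) = p ^ n) := by
  have hpp : p.Prime := Fact.out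
  constructor
  · intro K _ _ hK P
    obtain ⟨e, x, hx, hperm, hcore⟩ :=
      SL_sylow_properties p hp n hn K (Nat.pow_right_injective hpp.two_le hK) P
    exact ⟨⟨e, x, hx, hperm, CyclicWreath.exists_commutator_generators e hx,
        CyclicWreath.card_and_nilpotencyClass_commutator_sup hp hn e hx⟩,
      groupFusion_isSaturated P, hcore, (CyclicWreath.nilpotencyClass_of_mulEquiv hp hn e).2,
      CyclicWreath.exponent_center hn e⟩
  · obtain ⟨q, hq, hqn⟩ := exists_prime_padicValNat_sub_one p n hn
    have : Fact q.Prime := ⟨hq⟩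
    obtain ⟨P⟩ : Nonempty (Sylow p (Matrix.SpecialLinearGroup (Fin (p + 1)) (ZMod q))) :=
      inferInstance
    obtain ⟨e, x, hx, -, hcore⟩ :=
      SL_sylow_properties p hp n hn (ZMod q) (by rwa [Nat.card_zmod]) P
    obtain ⟨hnil, hclass⟩ := CyclicWreath.nilpotencyClass_of_mulEquiv hp hn e
    refine ⟨(P : Subgroup (Matrix.SpecialLinearGroup (Fin (p + 1)) (ZMod q))),
      Subgroup.toGroup _, groupFusion _, inferInstance, ?_, P.2, hnil, hclass.le,
      groupFusion_isSaturated P, hcore, CyclicWreath.exponent_center hn e⟩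
    by_contra h
    rw [not_nontrivial_iff_subsingleton] at h
    have h1 := CyclicWreath.exponent_center hn e
    rw [Monoid.exp_eq_one_iff.mpr inferInstance] at h1
    exact (Nat.one_lt_pow (by omega) hpp.one_lt).ne h1
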